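/- Let $\Omega\subset\mathbb{R}^3$ be a bounded domain with a $C^2$ boundary, $\Omega^c=\mathbb{R}^3\setminus\overline{\Omega}$, $\nu$ the unit outer normal of $\partial\Omega$, $\lambda,\kappa>0$, $0<\alpha<1$, and let $\mathcal{H}^e:\mathbb{R}^3\to\mathbb{R}^3$ satisfy $\mathcal{H}^e\in C^{2+\alpha}_{\rm loc}(\Omega^c,\mathbb{R}^3)\cap C^{1+\alpha}_{\rm loc}(\overline{\Omega^c},\mathbb{R}^3)$, $\operatorname{curl}\mathcal{H}^e=\mathbf 0$ and $\operatorname{div}\mathcal{H}^e=0$ in $\Omega^c$, and $\int_{\partial\Omega}\nu\cdot\mathcal{H}^e\,dS=0$. Let $\mathcal{A}(\Omega)$ be the set of $\mathbf{A}\in L^2_{\rm loc}(\mathbb{R}^3,\mathbb{R}^3)$ with weak curl in $L^2_{\rm loc}(\mathbb{R}^3,\mathbb{R}^3)$ and $\mathbf{A}\in L^\infty(\Omega,\mathbb{R}^3)$, and let $\mathcal{B}(\Omega)$ be the set of $\mathbf{B}\in\mathcal{A}(\Omega)$ such that $\operatorname{curl}\mathbf{B}\in L^2(\mathbb{R}^3,\mathbb{R}^3)$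 and the outer tangential trace $\mathbf{B}_T^+$ on $\partial\Omega$ (the trace from $\Omega^c$) lies in $H^{1/2}(\partial\Omega,\mathbb{R}^3)$. A pair $(f,\mathbf{A})$ is called a weak Meissner solution of the Meissner system $$\begin{cases}-\frac{\lambda^2}{\kappa^2}\Delta f=(1-f^2-|\mathbf{A}|^2)f,\quad \lambda^2\operatorname{curl}^2\mathbf{A}+f^2\mathbf{A}=\mathbf 0 & \text{in }\Omega,\\ \operatorname{curl}^2\mathbf{A}=\mathbf 0 & \text{in }\Omega^c,\\ \frac{\partial f}{\partial\nu}=0,\quad [\mathbf{A}_T]=\mathbf 0,\quad [(\operatorname{curl}\mathbf{A})_T]=\mathbf 0 & \text{on }\partial\Omega,\end{cases}\qquad \lambda\operatorname{curl}\mathbf{A}-\mathcal{H}^e\to\mathbf 0\ \text{ as }|x|\to\infty,$$ (where $[\cdot]$ is the jump across $\partial\Omega$) if 1. $f\in H^1(\Omega)$, $\mathbf{A}\in\mathcal{A}(\Omega)$ and $\operatorname{curl}\mathbf{A}-\lambda^{-1}\mathcal{H}^e\in L^2(\mathbb{R}^3,\mathbb{R}^3)$; 2. for all $g\in H^1(\Omega)$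 and $\mathbf{B}\in\mathcal{B}(\Omega)$, $$\int_\Omega\Big\{\frac{\lambda^2}{\kappa^2}\nabla f\cdot\nabla g-(1-f^2-|\mathbf{A}|^2)fg+f^2\mathbf{A}\cdot\mathbf{B}\Big\}dx+\int_{\mathbb{R}^3}\lambda(\lambda\operatorname{curl}\mathbf{A}-\mathcal{H}^e)\cdot\operatorname{curl}\mathbf{B}\,dx=0;$$ 3. $f>0$ on $\overline{\Omega}$, and the inner normal trace $\nu\cdot\mathbf{A}^-$ on $\partial\Omega$ (the trace from $\Omega$) vanishes in $H^{-1/2}(\partial\Omega)$. Suppose that $(f_0,\mathbf{A}_0)$ and $(f_1,\mathbf{A}_1)$ are two weak Meissner solutions (for the same $\Omega,\lambda,\kappa,\mathcal{H}^e$) which both satisfy $$\inf_{x\in\overline{\Omega}}\{f_j^2(x)-|\mathbf{A}_j(x)|^2\}>\tfrac13,\qquad j=0,1.$$ Then $$(f_0,\mathbf{A}_0)=(f_1,\mathbf{A}_1)\ \text{ a.e. in }\Omega,\qquad \operatorname{curl}\mathbf{A}_0=\operatorname{curl}\mathbf{A}_1\ \text{ a.e. in }\Omega^c.$$ Here pointwise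 conditions on $f_j,\mathbf{A}_j$ over $\overline{\Omega}$ are understood up to null sets, with the essential infimum over $\Omega$. -/

import Mathlib

open MeasureTheory

noncomputable section

namespace Meissner

/-- Three-dimensional Euclidean space. -/
abbrev E3 : Type := EuclideanSpace ℝ (Fin 3)

/-- The exterior region `Ω^c = ℝ³ \ closure Ω` (an open set). -/
def exterior (Ω : Set E3) : Set E3 := (closure Ω)ᶜ

/-! ### Classical differential operators -/

/-- The partial derivative `∂_j F_i`. -/
def pderiv (j i : Fin 3) (F : E3 → E3) (x : E3) : ℝ :=
  (fderiv ℝ F x (EuclideanSpace.single j 1)) i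

/-- The classical curl of a differentiable vector field. -/
def curl (F : E3 → E3) (x : E3) : E3 :=
  !₂[pderiv 1 2 F x - pderiv 2 1 F x,
     pderiv 2 0 F x - pderiv 0 2 F x,
     pderiv 0 1 F x - pderiv 1 0 F x]

/-- The classical divergence of a differentiable vector field. -/
def divg (F : E3 → E3) (x : E3) : ℝ := ∑ i, pderiv i i F x

/-! ### Domains with `C²` boundary -/

/-- `ρ` is a `C²` defining function of `Ω` in the open set `U`: `Ω ∩ U = {ρ < 0} ∩ U` and the
gradient of `ρ` does not vanish in `U`. (Hence `∂Ω ∩ U = {ρ = 0} ∩ U`, and `Ω` lies locally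
on one side of `∂Ω`.) -/
structure IsDefiningFunction (Ω U : Set E3) (ρ : E3 → ℝ) : Prop where
  isOpen : IsOpen U
  contDiffOn : ContDiffOn ℝ 2 ρ U
  gradient_ne_zero : ∀ x ∈ U, gradient ρ x ≠ 0
  mem_iff : ∀ x ∈ U, (x ∈ Ω ↔ ρ x < 0)

/-- The boundary of `Ω` is of class `C²`. -/
def HasC2Boundary (Ω : Set E3) : Prop :=
  ∀ p ∈ frontier Ω, ∃ U ρ, p ∈ U ∧ IsDefiningFunction Ω U ρ

/-- A bounded domain (non-empty connected open set) with a `C²` boundary. -/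
structure IsBoundedC2Domain (Ω : Set E3) : Prop where
  isOpen : IsOpen Ω
  isConnected : IsConnected Ω
  isBounded : Bornology.IsBounded Ω
  c2Boundary : HasC2Boundary Ω

/-- `n` is the unit normal of `∂Ω` at `p` that points out of `Ω`. -/
def IsOuterUnitNormal (Ω : Set E3) (p n : E3) : Prop :=
  ∃ U ρ, p ∈ U ∧ IsDefiningFunction Ω U ρ ∧ n = ‖gradient ρ p‖⁻¹ • gradient ρ p

open Classical in
/-- The unit outer normal `ν` on `∂Ω` (for a `C²` boundary it exists and is unique). -/
def outerUnitNormal (Ω : Set E3) (p : E3) : E3 :=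
  if h : ∃ n, IsOuterUnitNormal Ω p n then h.choose else 0

/-! ### The condition on the applied field -/

/-- `H ∈ C^{2+α}_loc(Ω^c, curl 0, div 0) ∩ C^{1+α}_loc(closure of Ω^c, ℝ³)` with zero flux through
`∂Ω`. The surface integral is with respect to the two-dimensional Hausdorff measure, which is a
constant multiple of the surface measure. -/
structure AppliedFieldCondition (Ω : Set E3) (α : NNReal) (H : E3 → E3) : Prop where
  /-- two continuous derivatives in the open set `Ω^c` -/
  contDiffOn : ContDiffOn ℝ 2 H (exterior Ω)
  /-- the second derivatives are `α`-Hölder continuous on compact subsets of `Ω^c` -/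
  holder_second : ∀ K, IsCompact K → K ⊆ exterior Ω →
    ∃ C, HolderOnWith C α (iteratedFDeriv ℝ 2 H) K
  curl_eq_zero : ∀ x ∈ exterior Ω, curl H x = 0
  div_eq_zero : ∀ x ∈ exterior Ω, divg H x = 0
  /-- continuity up to the boundary; the values on `∂Ω` are those of the outer trace -/
  continuousOn : ContinuousOn H (closure (exterior Ω))
  /-- the first derivatives are `α`-Hölder continuous up to the boundary, on bounded sets -/
  holder_first : ∀ R : ℝ, ∃ C,
    HolderOnWith C α (fderiv ℝ H) (exterior Ω ∩ Metric.ball 0 R)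
  flux_eq_zero :
    ∫ x in frontier Ω, inner ℝ (outerUnitNormal Ω x) (H x) ∂(Measure.hausdorffMeasure 2) = 0

/-! ### Weak derivatives and function spaces -/

/-- `φ ∈ C_c^∞(D, F)`. -/
def IsTestFunction {F : Type*} [NormedAddCommGroup F] [NormedSpace ℝ F]
    (D : Set E3) (φ : E3 → F) : Prop :=
  ContDiff ℝ (⊤ : ℕ∞) φ ∧ HasCompactSupport φ ∧ tsupport φ ⊆ D

/-- `G` is the weak gradient of `f` in the open set `D`. -/
structure IsWeakGrad (D : Set E3) (f : E3 → ℝ) (G : E3 → E3) : Prop where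
  locInt : LocallyIntegrableOn f D
  locInt_grad : LocallyIntegrableOn G D
  integral_eq : ∀ φ : E3 → ℝ, IsTestFunction D φ → ∀ i : Fin 3,
    ∫ x in D, f x * fderiv ℝ φ x (EuclideanSpace.single i 1) = -∫ x in D, G x i * φ x

open Classical in
/-- The weak gradient of `f` in `D`, unique up to null sets (and `0` if there is none). -/
def weakGrad (D : Set E3) (f : E3 → ℝ) : E3 → E3 :=
  if h : ∃ G, IsWeakGrad D f G then h.choose else 0

/-- The Sobolev space `H¹(D)`. -/
structure MemH1 (D : Set E3) (f : E3 → ℝ) : Prop where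
  memLp : MemLp f 2 (volume.restrict D)
  exists_weakGrad : ∃ G, IsWeakGrad D f G
  memLp_weakGrad : MemLp (weakGrad D f) 2 (volume.restrict D)

/-- `C` is the weak curl of the vector field `A` in `ℝ³`. -/
structure IsWeakCurl (A C : E3 → E3) : Prop where
  locInt : LocallyIntegrable A
  locInt_curl : LocallyIntegrable C
  integral_eq : ∀ φ : E3 → E3, IsTestFunction Set.univ φ →
    ∫ x, inner ℝ (A x) (curl φ x) = ∫ x, inner ℝ (C x) (φ x)

open Classical in
/-- The weak curl of `A` in `ℝ³`, unique up to null sets (and `0` if there is none). -/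
def weakCurl (A : E3 → E3) : E3 → E3 :=
  if h : ∃ C, IsWeakCurl A C then h.choose else 0

/-- `L²_loc(ℝ³, ℝ³)`. -/
def MemL2Loc (A : E3 → E3) : Prop :=
  ∀ K, IsCompact K → MemLp A 2 (volume.restrict K)

/-- `A ∈ 𝓐(Ω, ℝ³)`: `A ∈ L²_loc(ℝ³)` and `curl A ∈ L²_loc(ℝ³)`, and `A` is bounded in `Ω`. -/
structure MemA (Ω : Set E3) (A : E3 → E3) : Prop where
  memL2Loc : MemL2Loc A
  exists_weakCurl : ∃ C, IsWeakCurl A C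
  memL2Loc_curl : MemL2Loc (weakCurl A)
  bounded : MemLp A ⊤ (volume.restrict Ω)

/-- `A ∈ 𝓐(Ω, ℝ³, F)`: in addition `curl A - F ∈ L²(ℝ³)`. -/
structure MemAWith (Ω : Set E3) (F A : E3 → E3) : Prop extends MemA Ω A where
  memLp_sub : MemLp (fun x => weakCurl A x - F x) 2 volume

/-! ### Traces -/

/-- The pairing of the outer tangential trace of `B ∈ H_loc(ℝ³, curl)` on `∂Ω` with the test field
`φ`, given by Green's formula in `Ω^c`; with the normal `ν` pointing into `Ω^c`,
it equals `-∫_{∂Ω} (ν × B⁺) · φ dS` for regular `B`. -/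
def outerTangentialTrace (Ω : Set E3) (B φ : E3 → E3) : ℝ :=
  ∫ x in exterior Ω, (inner ℝ (weakCurl B x) (φ x) - inner ℝ (B x) (curl φ x))

/-- `B_T⁺ ∈ TH^{1/2}(∂Ω, ℝ³)`. As `H^{1/2}(∂Ω, ℝ³)` is the space of traces of fields in
`H¹(ℝ³, ℝ³)`, this says that `B` has the same outer tangential trace as some field
`U ∈ H¹(ℝ³, ℝ³)`. -/
def OuterTangentialTraceMemTH (Ω : Set E3) (B : E3 → E3) : Prop :=
  ∃ U : E3 → E3, (∀ i : Fin 3, MemH1 Set.univ (fun x => U x i)) ∧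
    ∀ φ : E3 → E3, IsTestFunction Set.univ φ →
      outerTangentialTrace Ω B φ = outerTangentialTrace Ω U φ

/-- `ν · A⁻ = 0` on `∂Ω` in `H^{-1/2}(∂Ω)`: the field `A` has a weak divergence `d ∈ L²(Ω)`, and its
inner normal trace, which is the functional `φ ↦ ∫_Ω (A · ∇φ + φ div A)` on `H¹(Ω)` by Green's
formula, vanishes. -/
def InnerNormalTraceEqZero (Ω : Set E3) (A : E3 → E3) : Prop :=
  ∃ d : E3 → ℝ, MemLp A 2 (volume.restrict Ω) ∧ MemLp d 2 (volume.restrict Ω) ∧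
    (∀ φ : E3 → ℝ, IsTestFunction Ω φ →
      ∫ x in Ω, inner ℝ (A x) (gradient φ x) = -∫ x in Ω, d x * φ x) ∧
    ∀ φ : E3 → ℝ, MemH1 Ω φ →
      ∫ x in Ω, (inner ℝ (A x) (weakGrad Ω φ x) + d x * φ x) = 0

/-- `B ∈ 𝓑(Ω, ℝ³)`, the space of test fields. -/
structure MemB (Ω : Set E3) (B : E3 → E3) : Prop extends MemA Ω B where
  memLp_curl : MemLp (weakCurl B) 2 volume
  trace : OuterTangentialTraceMemTH Ω B

/-! ### Weak solutions -/

/-- `(f, A)` is a weak solution of the Meissner system with applied field `H`, including the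
condition at infinity `λ curl A - H → 0`. -/
structure IsWeakSolution (Ω : Set E3) (lam κ : ℝ) (H : E3 → E3) (f : E3 → ℝ) (A : E3 → E3) :
    Prop where
  memH1 : MemH1 Ω f
  memA : MemAWith Ω (fun x => lam⁻¹ • H x) A
  weak_eq : ∀ (g : E3 → ℝ) (B : E3 → E3), MemH1 Ω g → MemB Ω B →
    (∫ x in Ω, (lam ^ 2 / κ ^ 2 * inner ℝ (weakGrad Ω f x) (weakGrad Ω g x)
        - (1 - f x ^ 2 - ‖A x‖ ^ 2) * f x * g x + f x ^ 2 * inner ℝ (A x) (B x)))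
      + ∫ x, lam * inner ℝ (lam • weakCurl A x - H x) (weakCurl B x) = 0

/-- A weak Meissner solution: moreover `f > 0` on the closed set `closure Ω`, that is `f` has a
positive essential lower bound in `Ω`, and the inner normal trace of `A` vanishes. -/
structure IsWeakMeissnerSolution (Ω : Set E3) (lam κ : ℝ) (H : E3 → E3) (f : E3 → ℝ)
    (A : E3 → E3) : Prop extends IsWeakSolution Ω lam κ H f A where
  pos : ∃ c > 0, ∀ᵐ x ∂(volume.restrict Ω), c ≤ f x
  normalTrace : InnerNormalTraceEqZero Ω A

/-- `inf (f² - |A|²) > 1/3` over `closure Ω`, as an essential infimum (`∂Ω` is a null set). -/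
def StabilityCondition (Ω : Set E3) (f : E3 → ℝ) (A : E3 → E3) : Prop :=
  ∃ c > (1 / 3 : ℝ), ∀ᵐ x ∂(volume.restrict Ω), c ≤ f x ^ 2 - ‖A x‖ ^ 2

end Meissner

end

noncomputable section

namespace Meissner

open Filter Topology ContinuousLinearMap
open scoped Convolution ENNReal

/-! ### Mollification -/

/-! Uniqueness is strict monotonicity. Testing both weak equations with the differences g = f₁ - f₀
and B = A₁ - A₀ and subtracting cancels the applied field and leaves ∫_Ω (λ²/κ² |∇g|² + `gradDiff`)
+ λ² ∫_ℝ³ |curl B|² = 0. Here `gradDiff` is the increment of the gradient of W(f, A) = (1 - f²)²/4 +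
f²|A|²/2 paired with (g, B). The Hessian of W has entries 3f² - 1 + |A|², 2fA and f²; for f > 0 it
is positive definite exactly when f² - |A|² > 1/3. The set of such (f, A) is convex, one side of a
two-sheeted hyperboloid. Hence `gradDiff` ≥ 0, all terms of the identity vanish, and so g = 0, B = 0
in Ω and curl B = 0 everywhere.

No integration along the segment is needed: W is a quartic polynomial, so `gradDiff` is the Hessian
form at the midpoint plus a nonnegative quartic remainder (`gradDiff_eq`). Then `midpoint_condition`
and `gradDiff_lower_bound` give the sign.

Two points of analysis justify the choice of test pair. First, f is only assumed to be in H¹, while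
the products f²A·B and f³g have to be integrable; `IsWeakSolution.memLp_sq` derives f ∈ L⁴ from the
equation itself, by testing with f/(1 + εf²) and letting ε → 0. This rests on a chain rule for weak
gradients (`IsWeakGrad.comp`). Second, A₁ - A₀ is not known to have an H^{1/2} tangential trace. Its
mollifications are smooth with curl in L², hence admissible (`memB_of_contDiff`), and
`IsWeakSolution.weak_eq_of_isWeakCurl` passes to the limit. `IsWeakMeissnerSolution.unique` puts the
pieces together. -/

/-- A sequence of bump functions at the origin with supports shrinking to a point. -/
def bump (n : ℕ) : ContDiffBump (0 : E3) where
  rIn := 1 / (2 * (n + 1))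
  rOut := 1 / (n + 1)
  rIn_pos := by positivity
  rIn_lt_rOut := by
    have : (0 : ℝ) < n + 1 := by positivity
    gcongr
    linarith

/-- The standard mollifying kernels. -/
def mollifier (n : ℕ) : E3 → ℝ := (bump n).normed volume

/-- Mollification of a function on `ℝ³`. -/
def mollify {F : Type*} [NormedAddCommGroup F] [NormedSpace ℝ F] (n : ℕ) (u : E3 → F) : E3 → F :=
  mollifier n ⋆[lsmul ℝ ℝ, volume] u

lemma bump_rOut (n : ℕ) : (bump n).rOut = 1 / ((n : ℝ) + 1) := rfl

lemma bump_rOut_le_one (n : ℕ) : (bump n).rOut ≤ 1 := by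
  rw [bump_rOut, div_le_one (by positivity)]
  linarith [(Nat.cast_nonneg n : (0 : ℝ) ≤ n)]

lemma tendsto_bump_rOut : Tendsto (fun n => (bump n).rOut) atTop (𝓝 0) :=
  tendsto_one_div_add_atTop_nhds_zero_nat

lemma mollifier_contDiff (n : ℕ) : ContDiff ℝ (⊤ : ℕ∞) (mollifier n) :=
  (bump n).contDiff_normed

lemma mollifier_hasCompactSupport (n : ℕ) : HasCompactSupport (mollifier n) :=
  (bump n).hasCompactSupport_normed

lemma mollifier_nonneg (n : ℕ) (x : E3) : 0 ≤ mollifier n x := (bump n).nonneg_normed x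

lemma integral_mollifier (n : ℕ) : ∫ x, mollifier n x = 1 := (bump n).integral_normed

lemma mollifier_eq_zero {n : ℕ} {x : E3} (hx : 1 ≤ ‖x‖) : mollifier n x = 0 := by
  have : x ∉ Function.support (mollifier n) := by
    rw [mollifier, (bump n).support_normed_eq]
    simpa using (bump_rOut_le_one n).trans hx
  simpa using this

lemma integrable_mollifier (n : ℕ) : Integrable (mollifier n) :=
  (mollifier_contDiff n).continuous.integrable_of_hasCompactSupport (mollifier_hasCompactSupport n)

variable {F : Type*} [NormedAddCommGroup F] [NormedSpace ℝ F]

lemma mollify_apply (n : ℕ) (u : E3 → F) (x : E3) :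
    mollify n u x = ∫ y, mollifier n y • u (x - y) := rfl

lemma mollify_apply' (n : ℕ) (u : E3 → F) (x : E3) :
    mollify n u x = ∫ y, mollifier n (x - y) • u y := by
  rw [mollify, convolution_eq_swap]; rfl

lemma mollify_contDiff (n : ℕ) {u : E3 → F} (hu : LocallyIntegrable u) :
    ContDiff ℝ (⊤ : ℕ∞) (mollify n u) :=
  (mollifier_hasCompactSupport n).contDiff_convolution_left _ (mollifier_contDiff n) hu

lemma integrable_mollifier_smul (n : ℕ) {u : E3 → F} (hu : LocallyIntegrable u) (x : E3) :
    Integrable fun y => mollifier n y • u (x - y) :=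
  ((mollifier_hasCompactSupport n).convolutionExists_left (lsmul ℝ ℝ)
    (mollifier_contDiff n).continuous hu) x

lemma mollify_sub (n : ℕ) {u v : E3 → F} (hu : LocallyIntegrable u) (hv : LocallyIntegrable v) :
    mollify n (u - v) = mollify n u - mollify n v := by
  ext x
  simp only [Pi.sub_apply, mollify_apply, smul_sub]
  exact integral_sub (integrable_mollifier_smul n hu x) (integrable_mollifier_smul n hv x)

lemma fderiv_mollify_apply [CompleteSpace F] (n : ℕ) {u : E3 → F} (hu : LocallyIntegrable u)
    (x v : E3) :
    fderiv ℝ (mollify n u) x v = ∫ y, fderiv ℝ (mollifier n) (x - y) v • u y := by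
  have hd : ContDiff ℝ 1 (mollifier n) := (mollifier_contDiff n).of_le (by simp)
  have h := (mollifier_hasCompactSupport n).hasFDerivAt_convolution_left (lsmul ℝ ℝ) hd hu x
  have hex := ((mollifier_hasCompactSupport n).fderiv ℝ).convolutionExists_left
    ((lsmul ℝ ℝ : ℝ →L[ℝ] F →L[ℝ] F).precompL E3) (hd.continuous_fderiv (by simp)) hu x
  rw [mollify, h.fderiv, convolution_eq_swap, ContinuousLinearMap.integral_apply]
  · rfl
  · exact hex.integrable_swap

/-- Mollification does not increase the `L²` norm. -/
lemma eLpNorm_mollify_le (n : ℕ) {u : E3 → F} (hu : AEStronglyMeasurable u volume) :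
    eLpNorm (mollify n u) 2 volume ≤ eLpNorm u 2 volume := by
  set w : E3 → ℝ≥0∞ := fun y => ENNReal.ofReal (mollifier n y) with hw
  have hwm : Measurable w := (mollifier_contDiff n).continuous.measurable.ennreal_ofReal
  -- The kernel is a probability density, so comparing the L¹ and L² norms under ν is Jensen's
  -- inequality. Tonelli and translation invariance then give the bound.
  set ν : Measure E3 := volume.withDensity w with hν
  have hprob : IsProbabilityMeasure ν := by
    refine ⟨?_⟩
    rw [hν, withDensity_apply _ MeasurableSet.univ, Measure.restrict_univ,
      ← ofReal_integral_eq_lintegral_ofReal (integrable_mollifier n)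
        (Eventually.of_forall (mollifier_nonneg n)), integral_mollifier, ENNReal.ofReal_one]
  have hac : ν ≪ volume := withDensity_absolutelyContinuous _ _
  have hshift : ∀ x : E3, AEStronglyMeasurable (fun y => u (x - y)) volume := fun x =>
    hu.comp_quasiMeasurePreserving (quasiMeasurePreserving_sub_left volume x)
  have hpt : ∀ x, ‖mollify n u x‖ₑ ^ 2 ≤ ∫⁻ y, w y * ‖u (x - y)‖ₑ ^ 2 := by
    intro x
    have h1 : ‖mollify n u x‖ₑ ≤ eLpNorm (fun y => u (x - y)) 1 ν := by
      rw [mollify_apply, eLpNorm_one_eq_lintegral_enorm, hν,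
        lintegral_withDensity_eq_lintegral_mul₀ hwm.aemeasurable (hshift x).enorm]
      refine (enorm_integral_le_lintegral_enorm _).trans (le_of_eq ?_)
      refine lintegral_congr fun y => ?_
      rw [enorm_smul, Real.enorm_of_nonneg (mollifier_nonneg n y)]; rfl
    have h2 := h1.trans (eLpNorm_le_eLpNorm_of_exponent_le (p := 1) (q := 2) (by norm_num)
      ((hshift x).mono_ac hac))
    calc ‖mollify n u x‖ₑ ^ 2 ≤ (eLpNorm (fun y => u (x - y)) 2 ν) ^ 2 := by gcongr
      _ = ∫⁻ y, ‖u (x - y)‖ₑ ^ 2 ∂ν := by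
        have := eLpNorm_nnreal_pow_eq_lintegral (f := fun y => u (x - y)) (p := 2) (μ := ν)
          (by norm_num)
        simp only [NNReal.coe_ofNat, ENNReal.rpow_ofNat] at this
        exact this
      _ = _ := by
        rw [hν, lintegral_withDensity_eq_lintegral_mul₀ hwm.aemeasurable
          ((hshift x).enorm.pow_const 2)]
        rfl
  have hm : AEMeasurable (Function.uncurry fun x y => w y * ‖u (x - y)‖ₑ ^ 2)
      ((volume : Measure E3).prod volume) := by
    refine (hwm.comp measurable_snd).aemeasurable.mul ?_
    exact (hu.comp_quasiMeasurePreserving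
      (quasiMeasurePreserving_sub volume volume)).enorm.pow_const 2
  have key : ∫⁻ x, ‖mollify n u x‖ₑ ^ 2 ≤ ∫⁻ x, ‖u x‖ₑ ^ 2 := by
    calc ∫⁻ x, ‖mollify n u x‖ₑ ^ 2 ≤ ∫⁻ x, ∫⁻ y, w y * ‖u (x - y)‖ₑ ^ 2 := lintegral_mono hpt
      _ = ∫⁻ y, ∫⁻ x, w y * ‖u (x - y)‖ₑ ^ 2 := lintegral_lintegral_swap hm
      _ = ∫⁻ y, w y * ∫⁻ x, ‖u x‖ₑ ^ 2 := by
        refine lintegral_congr fun y => ?_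
        rw [lintegral_const_mul' _ _ ENNReal.ofReal_ne_top,
          lintegral_sub_right_eq_self (fun x => ‖u x‖ₑ ^ 2) y]
      _ = (∫⁻ y, w y) * ∫⁻ x, ‖u x‖ₑ ^ 2 := lintegral_mul_const _ hwm
      _ = ∫⁻ x, ‖u x‖ₑ ^ 2 := by
        rw [hw, ← ofReal_integral_eq_lintegral_ofReal (integrable_mollifier n)
          (Eventually.of_forall (mollifier_nonneg n)), integral_mollifier, ENNReal.ofReal_one,
          one_mul]
  rw [eLpNorm_eq_lintegral_rpow_enorm_toReal (by norm_num) (by norm_num),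
    eLpNorm_eq_lintegral_rpow_enorm_toReal (by norm_num) (by norm_num)]
  gcongr ?_ ^ _
  simpa using key

lemma memLp_two_locallyIntegrable {F : Type*} [NormedAddCommGroup F] {u : E3 → F}
    (hu : MemLp u 2 volume) : LocallyIntegrable u :=
  hu.locallyIntegrable (by norm_num)

lemma memLp_mollify (n : ℕ) {u : E3 → F} (hu : MemLp u 2 volume) :
    MemLp (mollify n u) 2 volume :=
  ⟨(mollify_contDiff n (memLp_two_locallyIntegrable hu)).continuous.aestronglyMeasurable,
    (eLpNorm_mollify_le n hu.1).trans_lt hu.2⟩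

/-- Mollifications of a continuous function with compact support converge in `L²`. -/
lemma tendsto_eLpNorm_mollify_sub_of_continuous [CompleteSpace F] {h : E3 → F}
    (hc : Continuous h) (hs : HasCompactSupport h) :
    Tendsto (fun n => eLpNorm (mollify n h - h) 2 volume) atTop (𝓝 0) := by
  -- All kernels are supported in the closed unit ball, so one compact set contains the supports of
  -- h and of all its mollifications.
  set K : Set E3 := Metric.cthickening 1 (tsupport h) with hK
  have hKc : IsCompact K := hs.isCompact.cthickening
  have hKf : volume K ≠ ⊤ := hKc.measure_lt_top.ne
  have huc : UniformContinuous h := hs.uniformContinuous_of_continuous hc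
  have hout : ∀ n x, x ∉ K → (mollify n h - h) x = 0 := by
    intro n x hx
    have hx0 : h x = 0 := by
      by_contra hne
      exact hx (Metric.self_subset_cthickening _ (subset_tsupport _ hne))
    have : mollify n h x = 0 := by
      rw [mollify_apply]
      refine integral_eq_zero_of_ae (Eventually.of_forall fun y => ?_)
      by_cases hy : 1 ≤ ‖y‖
      · simp [mollifier_eq_zero hy]
      · have : h (x - y) = 0 := by
          by_contra hne
          refine hx (Metric.mem_cthickening_of_dist_le x (x - y) 1 _ (subset_tsupport _ hne) ?_)
          simpa [dist_eq_norm] using (not_le.1 hy).le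
        simp [this]
    simp [hx0, this]
  rw [ENNReal.tendsto_nhds_zero]
  intro ε hε
  -- A uniform bound δ on K costs δ · vol(K)^{1/2} in L².
  obtain ⟨δ, hδ, hδε⟩ : ∃ δ : NNReal, 0 < δ ∧ (δ : ℝ≥0∞) * volume K ^ (1 / 2 : ℝ) ≤ ε := by
    rcases eq_or_ne ε ⊤ with rfl | hε'
    · exact ⟨1, one_pos, le_top⟩
    · have hfin : volume K ^ (1 / 2 : ℝ) ≠ ⊤ := by simp [hKf]
      obtain ⟨δ, hδ, h⟩ := ENNReal.exists_nnreal_pos_mul_lt hfin hε.ne'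
      exact ⟨δ, hδ, h.le⟩
  obtain ⟨r, hr, hrδ⟩ := Metric.uniformContinuous_iff.1 huc δ hδ
  filter_upwards [tendsto_bump_rOut.eventually (gt_mem_nhds hr)] with n hn
  have hb : ∀ x, ‖(mollify n h - h) x‖ ≤ δ := by
    intro x
    rw [Pi.sub_apply, ← dist_eq_norm]
    refine (bump n).dist_normed_convolution_le hc.aestronglyMeasurable fun y hy => ?_
    exact (hrδ ((Metric.mem_ball.1 hy).trans hn)).le
  have : mollify n h - h = K.indicator (mollify n h - h) := by
    ext1 x
    by_cases hx : x ∈ K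
    · simp [hx]
    · rw [Set.indicator_of_notMem hx, hout n x hx]
  rw [this, eLpNorm_indicator_eq_eLpNorm_restrict hKc.measurableSet]
  refine (eLpNorm_le_of_ae_bound (C := δ) (Eventually.of_forall hb)).trans ?_
  refine le_trans (le_of_eq ?_) hδε
  rw [Measure.restrict_apply_univ, mul_comm]
  simp

/-- Mollifications converge in `L²`. -/
lemma tendsto_eLpNorm_mollify_sub [CompleteSpace F] {u : E3 → F} (hu : MemLp u 2 volume) :
    Tendsto (fun n => eLpNorm (mollify n u - u) 2 volume) atTop (𝓝 0) := by
  rw [ENNReal.tendsto_nhds_zero]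
  intro ε hε
  have hε3 : ε / 3 ≠ 0 := by simp [hε.ne']
  obtain ⟨h, hs, huh, hc, hmem⟩ := hu.exists_hasCompactSupport_eLpNorm_sub_le (by norm_num) hε3
  have hlu := memLp_two_locallyIntegrable hu
  have hlh := memLp_two_locallyIntegrable hmem
  filter_upwards [(ENNReal.tendsto_nhds_zero.1 (tendsto_eLpNorm_mollify_sub_of_continuous hc hs))
    (ε / 3) (pos_iff_ne_zero.2 hε3)] with n hn
  have hsplit : mollify n u - u = mollify n (u - h) + ((mollify n h - h) - (u - h)) := by
    rw [mollify_sub n hlu hlh]; abel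
  have hm1 := (memLp_mollify n (hu.sub hmem)).1
  have hm2 := ((memLp_mollify n hmem).sub hmem).1
  have hm3 := (hu.sub hmem).1
  calc eLpNorm (mollify n u - u) 2 volume
      ≤ eLpNorm (mollify n (u - h)) 2 volume
        + (eLpNorm (mollify n h - h) 2 volume + eLpNorm (u - h) 2 volume) := by
        rw [hsplit]
        refine (eLpNorm_add_le hm1 (hm2.sub hm3) (by norm_num)).trans ?_
        gcongr
        exact eLpNorm_sub_le hm2 hm3 (by norm_num)
    _ ≤ ε / 3 + (ε / 3 + ε / 3) := by
        gcongr
        exact (eLpNorm_mollify_le n hm3).trans huh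
    _ = ε := by rw [← add_assoc]; exact ENNReal.add_thirds ε

/-- Mollifications of a function in `L²_loc` converge in `L²` of bounded sets. -/
lemma tendsto_eLpNorm_mollify_sub_restrict {u : E3 → E3} (hu : MemL2Loc u) {D : Set E3}
    (hD : Bornology.IsBounded D) :
    Tendsto (fun n => eLpNorm (mollify n u - u) 2 (volume.restrict D)) atTop (𝓝 0) := by
  obtain ⟨R, hR⟩ := hD.subset_closedBall (0 : E3)
  -- Mollifying at a point of the ball of radius R only sees values within distance 1, so truncating
  -- u to radius R + 1 changes nothing there and makes it globally L².
  set K : Set E3 := Metric.closedBall 0 (R + 1) with hK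
  have hKm : MeasurableSet K := Metric.isClosed_closedBall.measurableSet
  have hv : MemLp (K.indicator u) 2 volume :=
    (memLp_indicator_iff_restrict hKm).2 (hu K (isCompact_closedBall _ _))
  have heq : ∀ n, ∀ x ∈ Metric.closedBall (0 : E3) R,
      (mollify n u - u) x = (mollify n (K.indicator u) - K.indicator u) x := by
    intro n x hx
    have hx' : ‖x‖ ≤ R := by simpa using hx
    have hxK : x ∈ K := by simp [hK]; linarith
    have : mollify n u x = mollify n (K.indicator u) x := by
      rw [mollify_apply, mollify_apply]
      refine integral_congr_ae (Eventually.of_forall fun y => ?_)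
      by_cases hy : 1 ≤ ‖y‖
      · simp [mollifier_eq_zero hy]
      · have : x - y ∈ K := by
          have := norm_sub_le x y
          simp only [hK, mem_closedBall_zero_iff]
          linarith
        simp [this]
    simp [hxK, this]
  refine tendsto_of_tendsto_of_tendsto_of_le_of_le tendsto_const_nhds
    (tendsto_eLpNorm_mollify_sub hv) (fun _ => zero_le) fun n => ?_
  calc eLpNorm (mollify n u - u) 2 (volume.restrict D)
      ≤ eLpNorm (mollify n u - u) 2 (volume.restrict (Metric.closedBall 0 R)) :=
        eLpNorm_mono_measure _ (Measure.restrict_mono hR le_rfl)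
    _ = eLpNorm (mollify n (K.indicator u) - K.indicator u) 2
          (volume.restrict (Metric.closedBall 0 R)) := by
        refine eLpNorm_congr_ae ?_
        filter_upwards [ae_restrict_mem Metric.isClosed_closedBall.measurableSet] with x hx
          using heq n x hx
    _ ≤ _ := eLpNorm_mono_measure _ Measure.restrict_le_self

/-! ### Convergence of `L²` pairings -/

/-- The integral is the inner product of the classes in the Hilbert space L², which is jointly
continuous. -/
lemma tendsto_integral_inner_of_tendsto_eLpNorm {X E : Type*} [MeasurableSpace X] {μ : Measure X}
    [NormedAddCommGroup E] [InnerProductSpace ℝ E]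
    {u v : X → E} {un vn : ℕ → X → E} (hu : MemLp u 2 μ) (hv : MemLp v 2 μ)
    (hun : ∀ n, MemLp (un n) 2 μ) (hvn : ∀ n, MemLp (vn n) 2 μ)
    (hlu : Tendsto (fun n => eLpNorm (un n - u) 2 μ) atTop (𝓝 0))
    (hlv : Tendsto (fun n => eLpNorm (vn n - v) 2 μ) atTop (𝓝 0)) :
    Tendsto (fun n => ∫ x, inner ℝ (un n x) (vn n x) ∂μ) atTop
      (𝓝 (∫ x, inner ℝ (u x) (v x) ∂μ)) := by
  have key : ∀ {a b : X → E} (ha : MemLp a 2 μ) (hb : MemLp b 2 μ),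
      ∫ x, inner ℝ (a x) (b x) ∂μ = inner ℝ (ha.toLp a) (hb.toLp b) := by
    intro a b ha hb
    rw [L2.inner_def]
    refine integral_congr_ae ?_
    filter_upwards [ha.coeFn_toLp, hb.coeFn_toLp] with x h1 h2
    rw [h1, h2]
  simp_rw [key hu hv, fun n => key (hun n) (hvn n)]
  exact ((Lp.tendsto_Lp_iff_tendsto_eLpNorm'' un hun u hu).2 hlu).inner
    ((Lp.tendsto_Lp_iff_tendsto_eLpNorm'' vn hvn v hv).2 hlv)

lemma tendsto_integral_inner_of_tendsto_eLpNorm_right {X E : Type*} [MeasurableSpace X]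
    {μ : Measure X} [NormedAddCommGroup E] [InnerProductSpace ℝ E]
    {u v : X → E} {vn : ℕ → X → E} (hu : MemLp u 2 μ) (hv : MemLp v 2 μ)
    (hvn : ∀ n, MemLp (vn n) 2 μ)
    (hlv : Tendsto (fun n => eLpNorm (vn n - v) 2 μ) atTop (𝓝 0)) :
    Tendsto (fun n => ∫ x, inner ℝ (u x) (vn n x) ∂μ) atTop (𝓝 (∫ x, inner ℝ (u x) (v x) ∂μ)) :=
  tendsto_integral_inner_of_tendsto_eLpNorm hu hv (fun _ => hu) hvn (by simp) hlv

/-! ### Weak gradients -/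

/-- The vector of partial derivatives of a scalar function. -/
def partials (u : E3 → ℝ) (x : E3) : E3 :=
  WithLp.toLp 2 fun i => fderiv ℝ u x (EuclideanSpace.single i 1)

lemma continuous_partials {u : E3 → ℝ} (hu : ContDiff ℝ 1 u) : Continuous (partials u) := by
  have := hu.continuous_fderiv (by simp)
  unfold partials
  fun_prop

lemma hasCompactSupport_partials {u : E3 → ℝ} (hs : HasCompactSupport u) :
    HasCompactSupport (partials u) :=
  (hs.fderiv ℝ).comp_left (g := fun T : E3 →L[ℝ] ℝ =>
    (WithLp.toLp 2 fun i => T (EuclideanSpace.single i 1) : E3)) (by ext; simp)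

/-- Integration by parts against a compactly supported function. -/
lemma integral_mul_fderiv_eq_neg {u φ : E3 → ℝ} (hu : ContDiff ℝ 1 u) (hφ : ContDiff ℝ 1 φ)
    (hs : HasCompactSupport φ) (v : E3) :
    ∫ x, u x * fderiv ℝ φ x v = -∫ x, fderiv ℝ u x v * φ x := by
  have h1 := hu.continuous_fderiv (by simp)
  have h2 := hφ.continuous_fderiv (by simp)
  refine integral_mul_fderiv_eq_neg_fderiv_mul_of_integrable ?_ ?_ ?_
    (fun x _ => hu.differentiable (by simp) x) (fun x _ => hφ.differentiable (by simp) x)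
  · exact ((h1.clm_apply continuous_const).mul hφ.continuous).integrable_of_hasCompactSupport
      hs.mul_left
  · refine (hu.continuous.mul (h2.clm_apply continuous_const)).integrable_of_hasCompactSupport
      (HasCompactSupport.mul_left (hs.fderiv_apply ℝ v))
  · exact (hu.continuous.mul hφ.continuous).integrable_of_hasCompactSupport hs.mul_left

lemma integrable_smul_of_locallyIntegrableOn {E : Type*} [NormedAddCommGroup E] [NormedSpace ℝ E]
    {D : Set E3} {u : E3 → E} {φ : E3 → ℝ} (hu : LocallyIntegrableOn u D) (hφ : Continuous φ)
    (hs : HasCompactSupport φ) (hD : tsupport φ ⊆ D) : Integrable fun x => φ x • u x := by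
  refine (integrableOn_iff_integrable_of_support_subset (s := tsupport φ) ?_).1 ?_
  · exact (Function.support_smul_subset_left _ _).trans (subset_tsupport _)
  · exact (hu.integrableOn_compact_subset hD hs.isCompact).continuousOn_smul hφ.continuousOn
      hs.isCompact

lemma LocallyIntegrableOn.coord {D : Set E3} {G : E3 → E3} (hG : LocallyIntegrableOn G D)
    (i : Fin 3) : LocallyIntegrableOn (fun x => G x i) D := fun x hx => by
  obtain ⟨s, hs, h⟩ := hG x hx
  exact ⟨s, hs, (EuclideanSpace.proj (𝕜 := ℝ) i).integrable_comp h⟩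

/-- The fundamental lemma of the calculus of variations, applied to each coordinate. It makes the
arbitrary choice in `weakGrad` harmless. -/
lemma IsWeakGrad.ae_eq {D : Set E3} (hD : IsOpen D) {f : E3 → ℝ} {G G' : E3 → E3}
    (h : IsWeakGrad D f G) (h' : IsWeakGrad D f G') : G =ᵐ[volume.restrict D] G' := by
  have hcomp : ∀ i : Fin 3, ∀ᵐ x, x ∈ D → G x i - G' x i = 0 := by
    intro i
    have l1 := LocallyIntegrableOn.coord h.locInt_grad i
    have l2 := LocallyIntegrableOn.coord h'.locInt_grad i
    refine hD.ae_eq_zero_of_integral_contDiff_smul_eq_zero (l1.sub l2) fun φ hφ hs hsD => ?_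
    have i1 := integrable_smul_of_locallyIntegrableOn l1 hφ.continuous hs hsD
    have i2 := integrable_smul_of_locallyIntegrableOn l2 hφ.continuous hs hsD
    have e := (h.integral_eq φ ⟨hφ, hs, hsD⟩ i).symm.trans (h'.integral_eq φ ⟨hφ, hs, hsD⟩ i)
    rw [neg_inj, setIntegral_eq_integral_of_forall_compl_eq_zero,
      setIntegral_eq_integral_of_forall_compl_eq_zero] at e
    · simp only [smul_sub]
      rw [integral_sub i1 i2, sub_eq_zero]
      simpa [mul_comm] using e
    all_goals
      intro x hx
      rw [image_eq_zero_of_notMem_tsupport fun hx' => hx (hsD hx'), mul_zero]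
  rw [EventuallyEq, ae_restrict_iff' hD.measurableSet]
  filter_upwards [hcomp 0, hcomp 1, hcomp 2] with x h0 h1 h2 hx
  ext i
  fin_cases i
  · exact sub_eq_zero.1 (h0 hx)
  · exact sub_eq_zero.1 (h1 hx)
  · exact sub_eq_zero.1 (h2 hx)

lemma isWeakGrad_weakGrad {D : Set E3} {f : E3 → ℝ} (h : ∃ G, IsWeakGrad D f G) :
    IsWeakGrad D f (weakGrad D f) := by
  rw [weakGrad, dif_pos h]
  exact h.choose_spec

lemma MemH1.isWeakGrad {D : Set E3} {f : E3 → ℝ} (h : MemH1 D f) :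
    IsWeakGrad D f (weakGrad D f) :=
  isWeakGrad_weakGrad h.exists_weakGrad

lemma IsWeakGrad.weakGrad_ae_eq {D : Set E3} (hD : IsOpen D) {f : E3 → ℝ} {G : E3 → E3}
    (h : IsWeakGrad D f G) : weakGrad D f =ᵐ[volume.restrict D] G :=
  (isWeakGrad_weakGrad ⟨G, h⟩).ae_eq hD h

lemma IsWeakGrad.memH1 {D : Set E3} (hD : IsOpen D) {f : E3 → ℝ} {G : E3 → E3}
    (h : IsWeakGrad D f G) (hf : MemLp f 2 (volume.restrict D))
    (hG : MemLp G 2 (volume.restrict D)) : MemH1 D f :=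
  ⟨hf, ⟨G, h⟩, hG.ae_eq (h.weakGrad_ae_eq hD).symm⟩

lemma IsWeakGrad.sub {D : Set E3} {f f' : E3 → ℝ} {G G' : E3 → E3}
    (h : IsWeakGrad D f G) (h' : IsWeakGrad D f' G') :
    IsWeakGrad D (fun x => f x - f' x) (fun x => G x - G' x) := by
  refine ⟨h.locInt.sub h'.locInt, h.locInt_grad.sub h'.locInt_grad, fun φ hφ i => ?_⟩
  obtain ⟨hc, hs, hsD⟩ := hφ
  have hd : Continuous fun x => fderiv ℝ φ x (EuclideanSpace.single i 1) :=
    (hc.continuous_fderiv (by simp)).clm_apply continuous_const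
  have hds : HasCompactSupport fun x => fderiv ℝ φ x (EuclideanSpace.single i 1) :=
    hs.fderiv_apply ℝ _
  have hdD : tsupport (fun x => fderiv ℝ φ x (EuclideanSpace.single i 1)) ⊆ D :=
    (tsupport_fderiv_apply_subset ℝ _).trans hsD
  have e1 := integrable_smul_of_locallyIntegrableOn h.locInt hd hds hdD
  have e2 := integrable_smul_of_locallyIntegrableOn h'.locInt hd hds hdD
  have e3 := integrable_smul_of_locallyIntegrableOn (LocallyIntegrableOn.coord h.locInt_grad i)
    hc.continuous hs hsD
  have e4 := integrable_smul_of_locallyIntegrableOn (LocallyIntegrableOn.coord h'.locInt_grad i)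
    hc.continuous hs hsD
  simp only [smul_eq_mul] at e1 e2 e3 e4
  simp_rw [mul_comm _ (f _)] at e1
  simp_rw [mul_comm _ (f' _)] at e2
  simp_rw [mul_comm (φ _)] at e3 e4
  simp only [PiLp.sub_apply, sub_mul]
  rw [integral_sub e1.integrableOn e2.integrableOn, integral_sub e3.integrableOn e4.integrableOn,
    h.integral_eq φ ⟨hc, hs, hsD⟩ i, h'.integral_eq φ ⟨hc, hs, hsD⟩ i]
  ring

lemma isWeakGrad_partials {u : E3 → ℝ} (hu : ContDiff ℝ 1 u) :
    IsWeakGrad Set.univ u (partials u) := by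
  refine ⟨hu.continuous.locallyIntegrable.locallyIntegrableOn _,
    (continuous_partials hu).locallyIntegrable.locallyIntegrableOn _, fun φ hφ i => ?_⟩
  rw [setIntegral_univ, setIntegral_univ,
    integral_mul_fderiv_eq_neg hu (hφ.1.of_le (by simp)) hφ.2.1]
  rfl

lemma memH1_univ_of_contDiff {u : E3 → ℝ} (hu : ContDiff ℝ 1 u) (hs : HasCompactSupport u) :
    MemH1 Set.univ u := by
  refine (isWeakGrad_partials hu).memH1 isOpen_univ ?_ ?_
  · exact (hu.continuous.memLp_of_hasCompactSupport hs).restrict _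
  · exact ((continuous_partials hu).memLp_of_hasCompactSupport
      (hasCompactSupport_partials hs)).restrict _

/-- Inserting this function into the definition of a weak derivative turns that definition into a
formula for the classical derivative of the mollification at x. -/
lemma isTestFunction_mollifier_sub {D : Set E3} {n : ℕ} {x : E3}
    (hx : Metric.closedBall x (bump n).rOut ⊆ D) :
    IsTestFunction D fun y => mollifier n (x - y) := by
  refine ⟨(mollifier_contDiff n).comp (contDiff_const.sub contDiff_id),
    (mollifier_hasCompactSupport n).comp_homeomorph (Homeomorph.subLeft x),
    (closure_minimal ?_ Metric.isClosed_closedBall).trans hx⟩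
  intro y hy
  have : x - y ∈ Function.support (mollifier n) := hy
  rw [mollifier, (bump n).support_normed_eq] at this
  rw [Metric.mem_closedBall, dist_comm, dist_eq_norm]
  exact (mem_ball_zero_iff.1 this).le

lemma fderiv_mollifier_sub (n : ℕ) (x y v : E3) :
    fderiv ℝ (fun y => mollifier n (x - y)) y v = -fderiv ℝ (mollifier n) (x - y) v := by
  have h1 : HasFDerivAt (mollifier n) (fderiv ℝ (mollifier n) (x - y)) (x - y) :=
    ((mollifier_contDiff n).differentiable (by simp) _).hasFDerivAt
  have h2 : HasFDerivAt (fun y => x - y) (-ContinuousLinearMap.id ℝ E3) y :=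
    (hasFDerivAt_id y).const_sub x
  have h3 : HasFDerivAt (fun y => mollifier n (x - y)) _ y := h1.comp y h2
  rw [h3.fderiv]
  simp

lemma integrable_mollifier_sub_smul {E : Type*} [NormedAddCommGroup E] [NormedSpace ℝ E]
    (n : ℕ) {u : E3 → E} (hu : LocallyIntegrable u) (x : E3) :
    Integrable fun y => mollifier n (x - y) • u y := by
  simpa using (integrable_mollifier_smul n hu x).comp_sub_left x

/-- Derivatives of mollifications, at distance larger than the mollification radius from the
complement of `D`. -/
lemma fderiv_mollify_indicator {D : Set E3} (hD : IsOpen D) {f : E3 → ℝ} {G : E3 → E3}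
    (h : IsWeakGrad D f G) (hf : LocallyIntegrable (D.indicator f))
    (hG : LocallyIntegrable (D.indicator G)) {n : ℕ} {x : E3}
    (hx : Metric.closedBall x (bump n).rOut ⊆ D) (i : Fin 3) :
    fderiv ℝ (mollify n (D.indicator f)) x (EuclideanSpace.single i 1) =
      mollify n (D.indicator G) x i := by
  set φ : E3 → ℝ := fun y => mollifier n (x - y) with hφ
  have e := h.integral_eq φ (isTestFunction_mollifier_sub hx) i
  rw [fderiv_mollify_apply n hf, mollify_apply']
  have e1 : (∫ y, mollifier n (x - y) • D.indicator G y) i = ∫ y in D, G y i * φ y := by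
    have := (EuclideanSpace.proj (𝕜 := ℝ) i).integral_comp_comm
      (integrable_mollifier_sub_smul n hG x)
    refine this.symm.trans ?_
    rw [← integral_indicator hD.measurableSet]
    refine integral_congr_ae (Eventually.of_forall fun y => ?_)
    by_cases hy : y ∈ D <;> simp [hy, hφ, mul_comm]
  have e2 : ∫ y, fderiv ℝ (mollifier n) (x - y) (EuclideanSpace.single i 1) • D.indicator f y
      = -∫ y in D, f y * fderiv ℝ φ y (EuclideanSpace.single i 1) := by
    rw [← integral_indicator hD.measurableSet, ← integral_neg]
    refine integral_congr_ae (Eventually.of_forall fun y => ?_)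
    by_cases hy : y ∈ D <;> simp [hy, hφ, fderiv_mollifier_sub, mul_comm]
  rw [e1, e2, e, neg_neg]

lemma tendsto_eLpNorm_sub_of_le_mul {X E E' : Type*} [MeasurableSpace X] {μ : Measure X}
    [NormedAddCommGroup E] [NormedAddCommGroup E'] {a : X → E} {b : X → E'} {an : ℕ → X → E}
    {bn : ℕ → X → E'} (c : ℝ) (hle : ∀ n x, ‖an n x - a x‖ ≤ c * ‖bn n x - b x‖)
    (hb : Tendsto (fun n => eLpNorm (bn n - b) 2 μ) atTop (𝓝 0)) :
    Tendsto (fun n => eLpNorm (an n - a) 2 μ) atTop (𝓝 0) := by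
  have h2 : Tendsto (fun n => ENNReal.ofReal c * eLpNorm (bn n - b) 2 μ) atTop (𝓝 0) := by
    simpa using ENNReal.Tendsto.const_mul hb (Or.inr ENNReal.ofReal_ne_top)
  exact tendsto_of_tendsto_of_tendsto_of_le_of_le tendsto_const_nhds h2 (fun _ => zero_le)
    fun n => eLpNorm_le_mul_eLpNorm_of_ae_le_mul (Eventually.of_forall (hle n)) 2

lemma MemLp.locallyIntegrableOn_two {E : Type*} [NormedAddCommGroup E] {D : Set E3} {u : E3 → E}
    (hu : MemLp u 2 (volume.restrict D)) : LocallyIntegrableOn u D :=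
  locallyIntegrableOn_of_locallyIntegrable_restrict (hu.locallyIntegrable (by norm_num))

/-- Chain rule for weak gradients. -/
lemma IsWeakGrad.comp {D : Set E3} (hD : IsOpen D) {f : E3 → ℝ} {G : E3 → E3}
    (h : IsWeakGrad D f G) (hf : MemLp f 2 (volume.restrict D))
    (hG : MemLp G 2 (volume.restrict D)) {ψ ψ' : ℝ → ℝ} (hψ : ContDiff ℝ 1 ψ)
    (hψ' : ∀ s, HasDerivAt ψ (ψ' s) s) (h0 : ψ 0 = 0) {M : ℝ} (hM : ∀ s, |ψ' s| ≤ M)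
    {C : ℝ} (hC : ∀ s t, |ψ' s - ψ' t| ≤ C * |s - t|) :
    IsWeakGrad D (fun x => ψ (f x)) (fun x => ψ' (f x) • G x) := by
  have hcψ' : Continuous ψ' := by
    have : ψ' = deriv ψ := funext fun s => (hψ' s).deriv.symm
    rw [this]
    exact hψ.continuous_deriv (by simp)
  have hlip : ∀ s t, |ψ s - ψ t| ≤ M * |s - t| := fun s t =>
    convex_univ.norm_image_sub_le_of_norm_hasDerivWithin_le (f := ψ) (f' := ψ')
      (fun x _ => (hψ' x).hasDerivWithinAt) (fun x _ => hM x) (Set.mem_univ t) (Set.mem_univ s)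
  have hψL2 : ∀ {μ : Measure E3} {u : E3 → ℝ}, MemLp u 2 μ → MemLp (fun x => ψ (u x)) 2 μ := by
    intro μ u hu
    refine hu.of_le_mul (c := M) (hψ.continuous.comp_aestronglyMeasurable hu.1)
      (Eventually.of_forall fun x => ?_)
    simpa [h0] using hlip (u x) 0
  have hfi : MemLp (D.indicator f) 2 volume := (memLp_indicator_iff_restrict hD.measurableSet).2 hf
  have hGi : MemLp (D.indicator G) 2 volume := (memLp_indicator_iff_restrict hD.measurableSet).2 hG
  have hlf := memLp_two_locallyIntegrable hfi
  have hlG := memLp_two_locallyIntegrable hGi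
  refine ⟨MemLp.locallyIntegrableOn_two (hψL2 hf), ?_, ?_⟩
  · refine MemLp.locallyIntegrableOn_two (hG.of_le_mul (c := M)
      ((hcψ'.comp_aestronglyMeasurable hf.1).smul hG.1) (Eventually.of_forall fun x => ?_))
    rw [norm_smul]
    gcongr
    exact hM _
  intro φ hφ i
  obtain ⟨hc, hs, hsD⟩ := hφ
  set dφ : E3 → ℝ := fun x => fderiv ℝ φ x (EuclideanSpace.single i 1) with hdφ
  have hd : Continuous dφ := (hc.continuous_fderiv (by simp)).clm_apply continuous_const
  have hds : HasCompactSupport dφ := hs.fderiv_apply ℝ _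
  have hdm : MemLp dφ 2 volume := hd.memLp_of_hasCompactSupport hds
  have hφm : MemLp φ 2 volume := hc.continuous.memLp_of_hasCompactSupport hs
  obtain ⟨c, hcφ⟩ := hs.exists_bound_of_continuous hc.continuous
  set fn : ℕ → E3 → ℝ := fun n => mollify n (D.indicator f) with hfn
  set Gn : ℕ → E3 → E3 := fun n => mollify n (D.indicator G) with hGn
  -- Extension by zero may destroy weak differentiability across ∂D, but the L² convergence is
  -- global and derivatives are compared only on the support of φ.
  have tf : Tendsto (fun n => eLpNorm (fn n - D.indicator f) 2 volume) atTop (𝓝 0) :=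
    tendsto_eLpNorm_mollify_sub hfi
  have tG : Tendsto (fun n => eLpNorm (Gn n - D.indicator G) 2 volume) atTop (𝓝 0) :=
    tendsto_eLpNorm_mollify_sub hGi
  have hM0 : 0 ≤ M := (abs_nonneg _).trans (hM 0)
  have hψφ : ∀ {u : E3 → ℝ}, AEStronglyMeasurable u volume →
      MemLp (fun x => ψ' (u x) * φ x) 2 volume := fun {u} hu =>
    hφm.of_le_mul (c := M) ((hcψ'.comp_aestronglyMeasurable hu).mul hφm.1)
      (Eventually.of_forall fun x => by
        rw [norm_mul]
        gcongr
        exact hM _)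
  have hcoord : ∀ {V : E3 → E3}, MemLp V 2 volume → MemLp (fun x => V x i) 2 volume := fun hV =>
    (EuclideanSpace.proj (𝕜 := ℝ) i).comp_memLp' hV
  have T1 := tendsto_integral_inner_of_tendsto_eLpNorm_right hdm (hψL2 hfi)
    (fun n => hψL2 (memLp_mollify n hfi))
    (tendsto_eLpNorm_sub_of_le_mul (an := fun n x => ψ (fn n x)) M (fun n x => hlip _ _) tf)
  -- Both factors vary with n, so both must converge in L². For ψ'(fₙ)φ this uses that ψ' is
  -- Lipschitz and φ bounded.
  have T2 := tendsto_integral_inner_of_tendsto_eLpNorm (hψφ hfi.1) (hcoord hGi)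
    (fun n => hψφ (memLp_mollify n hfi).1) (fun n => hcoord (memLp_mollify n hGi))
    (tendsto_eLpNorm_sub_of_le_mul (an := fun n x => ψ' (fn n x) * φ x) (C * c)
      (fun n x => by
        rw [← sub_mul, norm_mul]
        calc ‖ψ' (fn n x) - ψ' (D.indicator f x)‖ * ‖φ x‖
            ≤ (C * ‖fn n x - D.indicator f x‖) * c := by
              gcongr
              · exact (abs_nonneg _).trans (hC (fn n x) (D.indicator f x))
              · exact hC _ _
              · exact hcφ x
          _ = C * c * ‖fn n x - D.indicator f x‖ := by ring) tf)
    (tendsto_eLpNorm_sub_of_le_mul (an := fun n x => Gn n x i) 1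
      (fun n x => by
        rw [one_mul, ← PiLp.sub_apply]
        exact PiLp.norm_apply_le _ i) tG)
  -- Once the kernel radius is below δ, kernels centred on the support of φ stay inside D, where Gₙ
  -- is the gradient of fₙ.
  obtain ⟨δ, hδ, hδD⟩ := hs.isCompact.exists_cthickening_subset_open hD hsD
  have hev : ∀ᶠ n in atTop, ∫ x, inner ℝ (dφ x) (ψ (fn n x)) =
      -∫ x, inner ℝ (ψ' (fn n x) * φ x) (Gn n x i) := by
    filter_upwards [tendsto_bump_rOut.eventually (gt_mem_nhds hδ)] with n hn
    have hfc : ContDiff ℝ 1 (fn n) := (mollify_contDiff n hlf).of_le (by simp)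
    have ibp := integral_mul_fderiv_eq_neg (hψ.comp hfc) (hc.of_le (by simp)) hs
      (EuclideanSpace.single i 1)
    refine Eq.trans ?_ (ibp.trans ?_)
    · rfl
    · congr 1
      refine integral_congr_ae (Eventually.of_forall fun x => ?_)
      by_cases hx : x ∈ tsupport φ
      · have hball : Metric.closedBall x (bump n).rOut ⊆ D := by
          refine Set.Subset.trans (fun y hy => ?_) hδD
          exact Metric.mem_cthickening_of_dist_le y x δ _ hx
            ((Metric.mem_closedBall.1 hy).trans hn.le)
        have hder : HasFDerivAt (ψ ∘ fn n) (ψ' (fn n x) • fderiv ℝ (fn n) x) x :=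
          (hψ' _).comp_hasFDerivAt x (hfc.differentiable (by simp) x).hasFDerivAt
        have hfd : fderiv ℝ (fn n) x (EuclideanSpace.single i 1) = Gn n x i :=
          fderiv_mollify_indicator hD h hlf hlG hball i
        change fderiv ℝ (ψ ∘ fn n) x (EuclideanSpace.single i 1) * φ x =
          Gn n x i * (ψ' (fn n x) * φ x)
        rw [hder.fderiv, _root_.smul_apply, hfd, smul_eq_mul]
        ring
      · simp [image_eq_zero_of_notMem_tsupport hx]
  have hlim := tendsto_nhds_unique (T1.congr' hev) T2.neg
  have hz : ∀ x ∉ D, φ x = 0 := fun x hx =>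
    image_eq_zero_of_notMem_tsupport fun hx' => hx (hsD hx')
  have hz' : ∀ x ∉ D, dφ x = 0 := fun x hx =>
    image_eq_zero_of_notMem_tsupport fun hx' => hx (hsD (tsupport_fderiv_apply_subset ℝ _ hx'))
  rw [← integral_indicator hD.measurableSet, ← integral_indicator hD.measurableSet]
  convert hlim using 1
  · refine integral_congr_ae (Eventually.of_forall fun x => ?_)
    by_cases hx : x ∈ D
    · simp [hx, hdφ]
    · simp [hx, hz' x hx]
  · congr 1
    refine integral_congr_ae (Eventually.of_forall fun x => ?_)
    by_cases hx : x ∈ D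
    · simp [hx]
      ring
    · simp [hx]

/-! ### Weak curls -/

lemma inner_eq_three (a b : E3) : inner ℝ a b = a 0 * b 0 + a 1 * b 1 + a 2 * b 2 := by
  simp [PiLp.inner_apply, Fin.sum_univ_three, mul_comm]

lemma contDiff_coord {W : E3 → E3} {k : WithTop ℕ∞} (hW : ContDiff ℝ k W) (i : Fin 3) :
    ContDiff ℝ k fun x => W x i :=
  (EuclideanSpace.proj (𝕜 := ℝ) i).contDiff.comp hW

lemma pderiv_eq_fderiv_coord {W : E3 → E3} {x : E3} (hW : DifferentiableAt ℝ W x) (j i : Fin 3) :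
    pderiv j i W x = fderiv ℝ (fun y => W y i) x (EuclideanSpace.single j 1) := by
  have h : HasFDerivAt (fun y => W y i)
      ((EuclideanSpace.proj (𝕜 := ℝ) i).comp (fderiv ℝ W x)) x :=
    (EuclideanSpace.proj (𝕜 := ℝ) i).hasFDerivAt.comp x hW.hasFDerivAt
  rw [h.fderiv]
  rfl

lemma continuous_pderiv {W : E3 → E3} (hW : ContDiff ℝ 1 W) (j i : Fin 3) :
    Continuous (pderiv j i W) := by
  have := hW.continuous_fderiv (by simp)
  unfold pderiv
  fun_prop

lemma continuous_curl {W : E3 → E3} (hW : ContDiff ℝ 1 W) : Continuous (curl W) := by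
  have := continuous_pderiv hW
  unfold curl
  fun_prop

lemma hasCompactSupport_pderiv {φ : E3 → E3} (hs : HasCompactSupport φ) (j i : Fin 3) :
    HasCompactSupport (pderiv j i φ) :=
  (hs.fderiv ℝ).comp_left (g := fun T : E3 →L[ℝ] E3 => T (EuclideanSpace.single j 1) i) (by simp)

lemma hasCompactSupport_curl {φ : E3 → E3} (hs : HasCompactSupport φ) :
    HasCompactSupport (curl φ) := by
  refine (hs.fderiv ℝ).mono' ((Function.support_subset_iff'.2 fun x hx => ?_).trans
    (subset_tsupport _))
  have : fderiv ℝ φ x = 0 := by simpa using hx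
  ext i
  fin_cases i <;> simp [curl, pderiv, this]

lemma curl_congr {V W : E3 → E3} {x : E3} (h : V =ᶠ[𝓝 x] W) : curl V x = curl W x := by
  simp [curl, pderiv, h.fderiv_eq]

lemma curl_zero (x : E3) : curl (fun _ => 0) x = 0 := by
  ext i
  fin_cases i <;> simp [curl, pderiv]

lemma integral_mul_pderiv_eq_neg {W φ : E3 → E3} (hW : ContDiff ℝ 1 W) (hφ : ContDiff ℝ 1 φ)
    (hs : HasCompactSupport φ) (i j l : Fin 3) :
    ∫ x, W x i * pderiv j l φ x = -∫ x, pderiv j i W x * φ x l := by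
  simp_rw [fun x => pderiv_eq_fderiv_coord (hW.differentiable (by simp) x) j i,
    fun x => pderiv_eq_fderiv_coord (hφ.differentiable (by simp) x) j l]
  exact integral_mul_fderiv_eq_neg (contDiff_coord hW i) (contDiff_coord hφ l)
    (hs.comp_left (g := fun v : E3 => v l) (by simp)) _

lemma integral_add_sub_three {X : Type*} [MeasurableSpace X] {μ : Measure X}
    {a b c d e f : X → ℝ} (ha : Integrable a μ) (hb : Integrable b μ) (hc : Integrable c μ)
    (hd : Integrable d μ) (he : Integrable e μ) (hf : Integrable f μ) :
    ∫ x, ((a x - b x) + (c x - d x) + (e x - f x)) ∂μ =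
      (∫ x, a x ∂μ - ∫ x, b x ∂μ) + (∫ x, c x ∂μ - ∫ x, d x ∂μ)
        + (∫ x, e x ∂μ - ∫ x, f x ∂μ) := by
  have h1 : Integrable (fun x => a x - b x) μ := ha.sub hb
  have h2 : Integrable (fun x => c x - d x) μ := hc.sub hd
  have h3 : Integrable (fun x => e x - f x) μ := he.sub hf
  have h4 : Integrable (fun x => (a x - b x) + (c x - d x)) μ := h1.add h2
  rw [integral_add h4 h3, integral_add h1 h2, integral_sub ha hb, integral_sub hc hd,
    integral_sub he hf]

/-- Green's formula for the curl. -/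
lemma integral_inner_curl_eq {W φ : E3 → E3} (hW : ContDiff ℝ 1 W) (hφ : ContDiff ℝ 1 φ)
    (hs : HasCompactSupport φ) :
    ∫ x, inner ℝ (W x) (curl φ x) = ∫ x, inner ℝ (curl W x) (φ x) := by
  have hI : ∀ i j l : Fin 3, Integrable fun x => W x i * pderiv j l φ x := fun i j l =>
    ((contDiff_coord hW i).continuous.mul
      (continuous_pderiv hφ j l)).integrable_of_hasCompactSupport
      (HasCompactSupport.mul_left (hasCompactSupport_pderiv hs j l))
  have hJ : ∀ i j l : Fin 3, Integrable fun x => pderiv j i W x * φ x l := fun i j l =>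
    ((continuous_pderiv hW j i).mul
      (contDiff_coord hφ l).continuous).integrable_of_hasCompactSupport
      (HasCompactSupport.mul_left (hs.comp_left (g := fun v : E3 => v l) (by simp)))
  have e1 : ∀ x, inner ℝ (W x) (curl φ x) =
      (W x 0 * pderiv 1 2 φ x - W x 0 * pderiv 2 1 φ x)
      + (W x 1 * pderiv 2 0 φ x - W x 1 * pderiv 0 2 φ x)
      + (W x 2 * pderiv 0 1 φ x - W x 2 * pderiv 1 0 φ x) := fun x => by
    simp [inner_eq_three, curl]; ring
  have e2 : ∀ x, inner ℝ (curl W x) (φ x) =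
      (pderiv 1 2 W x * φ x 0 - pderiv 2 1 W x * φ x 0)
      + (pderiv 2 0 W x * φ x 1 - pderiv 0 2 W x * φ x 1)
      + (pderiv 0 1 W x * φ x 2 - pderiv 1 0 W x * φ x 2) := fun x => by
    simp [inner_eq_three, curl]; ring
  simp_rw [e1, e2]
  rw [integral_add_sub_three (hI _ _ _) (hI _ _ _) (hI _ _ _) (hI _ _ _) (hI _ _ _) (hI _ _ _),
    integral_add_sub_three (hJ _ _ _) (hJ _ _ _) (hJ _ _ _) (hJ _ _ _) (hJ _ _ _) (hJ _ _ _)]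
  simp_rw [integral_mul_pderiv_eq_neg hW hφ hs]
  ring

lemma isWeakCurl_curl {W : E3 → E3} (hW : ContDiff ℝ 1 W) : IsWeakCurl W (curl W) :=
  ⟨hW.continuous.locallyIntegrable, (continuous_curl hW).locallyIntegrable,
    fun _ hφ => integral_inner_curl_eq hW (hφ.1.of_le (by simp)) hφ.2.1⟩

lemma isTestFunction_smul_single {D : Set E3} {g : E3 → ℝ} (hg : IsTestFunction D g) (k : Fin 3) :
    IsTestFunction D fun x => g x • (EuclideanSpace.single k 1 : E3) :=
  ⟨hg.1.smul contDiff_const, hg.2.1.smul_right,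
    (closure_mono (Function.support_smul_subset_left _ _)).trans hg.2.2⟩

/-- Identities between vector-valued integrals reduce to pairings with the test fields g eₖ, the
form in which weak curls are defined. -/
lemma integral_smul_coord {g : E3 → ℝ} {C : E3 → E3} (h : Integrable fun x => g x • C x)
    (k : Fin 3) :
    (∫ x, g x • C x) k = ∫ x, inner ℝ (C x) (g x • (EuclideanSpace.single k 1 : E3)) := by
  refine ((EuclideanSpace.proj (𝕜 := ℝ) k).integral_comp_comm h).symm.trans ?_
  refine integral_congr_ae (Eventually.of_forall fun x => ?_)
  simp [inner_smul_right, EuclideanSpace.inner_single_right]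

lemma integrable_smul_of_locallyIntegrable {g : E3 → ℝ} {C : E3 → E3} (hC : LocallyIntegrable C)
    (hg : Continuous g) (hs : HasCompactSupport g) : Integrable fun x => g x • C x :=
  integrable_smul_of_locallyIntegrableOn (hC.locallyIntegrableOn Set.univ) hg hs (Set.subset_univ _)

lemma IsWeakCurl.ae_eq {A C C' : E3 → E3} (h : IsWeakCurl A C) (h' : IsWeakCurl A C') :
    C =ᵐ[volume] C' := by
  refine ae_eq_of_integral_contDiff_smul_eq h.locInt_curl h'.locInt_curl fun g hg hs => ?_
  ext k
  rw [integral_smul_coord (integrable_smul_of_locallyIntegrable h.locInt_curl hg.continuous hs),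
    integral_smul_coord (integrable_smul_of_locallyIntegrable h'.locInt_curl hg.continuous hs)]
  have ht := isTestFunction_smul_single (D := Set.univ) ⟨hg, hs, Set.subset_univ _⟩ k
  exact (h.integral_eq _ ht).symm.trans (h'.integral_eq _ ht)

lemma isWeakCurl_weakCurl {A : E3 → E3} (h : ∃ C, IsWeakCurl A C) : IsWeakCurl A (weakCurl A) := by
  rw [weakCurl, dif_pos h]
  exact h.choose_spec

lemma IsWeakCurl.weakCurl_ae_eq {A C : E3 → E3} (h : IsWeakCurl A C) : weakCurl A =ᵐ[volume] C :=
  (isWeakCurl_weakCurl ⟨C, h⟩).ae_eq h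

lemma integrable_inner_of_locallyIntegrable {C φ : E3 → E3} (hC : LocallyIntegrable C)
    (hφ : Continuous φ) (hs : HasCompactSupport φ) : Integrable fun x => inner ℝ (C x) (φ x) := by
  have hcoord : ∀ k : Fin 3, Integrable fun x => C x k * φ x k := fun k => by
    have := integrable_smul_of_locallyIntegrableOn
      (LocallyIntegrableOn.coord (hC.locallyIntegrableOn Set.univ) k)
      ((EuclideanSpace.proj (𝕜 := ℝ) k).continuous.comp hφ)
      (hs.comp_left (g := fun v : E3 => v k) (by simp)) (Set.subset_univ _)
    simpa [mul_comm] using this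
  simp_rw [inner_eq_three]
  exact ((hcoord 0).add (hcoord 1)).add (hcoord 2)

lemma IsWeakCurl.sub {A A' C C' : E3 → E3} (h : IsWeakCurl A C) (h' : IsWeakCurl A' C') :
    IsWeakCurl (fun x => A x - A' x) (fun x => C x - C' x) := by
  refine ⟨h.locInt.sub h'.locInt, h.locInt_curl.sub h'.locInt_curl, fun φ hφ => ?_⟩
  have hc : ContDiff ℝ 1 φ := hφ.1.of_le (by simp)
  have hcc := continuous_curl hc
  have hcs := hasCompactSupport_curl hφ.2.1
  simp only [inner_sub_left]
  rw [integral_sub (integrable_inner_of_locallyIntegrable h.locInt hcc hcs)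
      (integrable_inner_of_locallyIntegrable h'.locInt hcc hcs),
    integral_sub (integrable_inner_of_locallyIntegrable h.locInt_curl hc.continuous hφ.2.1)
      (integrable_inner_of_locallyIntegrable h'.locInt_curl hc.continuous hφ.2.1),
    h.integral_eq φ hφ, h'.integral_eq φ hφ]

/-- Mollification commutes with the weak curl. -/
lemma IsWeakCurl.curl_mollify {A C : E3 → E3} (h : IsWeakCurl A C) (n : ℕ) :
    curl (mollify n A) = mollify n C := by
  ext x k
  have ht := isTestFunction_mollifier_sub (D := Set.univ) (n := n) (x := x) (Set.subset_univ _)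
  have hC : mollify n C x k = ∫ y, inner ℝ (A y)
      (curl (fun y => mollifier n (x - y) • (EuclideanSpace.single k 1 : E3)) y) := by
    rw [mollify_apply', integral_smul_coord (integrable_mollifier_sub_smul n h.locInt_curl x),
      h.integral_eq _ (isTestFunction_smul_single ht k)]
  have hdη : ∀ v : E3, Continuous fun y => fderiv ℝ (mollifier n) (x - y) v := fun v =>
    (((mollifier_contDiff n).continuous_fderiv (by simp)).comp
      (continuous_const.sub continuous_id)).clm_apply continuous_const
  have hdηs : ∀ v : E3, HasCompactSupport fun y => fderiv ℝ (mollifier n) (x - y) v := fun v =>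
    ((mollifier_hasCompactSupport n).fderiv_apply ℝ v).comp_homeomorph (Homeomorph.subLeft x)
  have hint : ∀ j, Integrable fun y =>
      fderiv ℝ (mollifier n) (x - y) (EuclideanSpace.single j 1) • A y := fun j =>
    integrable_smul_of_locallyIntegrable h.locInt (hdη _) (hdηs _)
  have hintc : ∀ j i : Fin 3, Integrable fun y =>
      fderiv ℝ (mollifier n) (x - y) (EuclideanSpace.single j 1) * A y i := fun j i =>
    (EuclideanSpace.proj (𝕜 := ℝ) i).integrable_comp (hint j)
  have hp : ∀ j i : Fin 3, pderiv j i (mollify n A) x =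
      ∫ y, fderiv ℝ (mollifier n) (x - y) (EuclideanSpace.single j 1) * A y i := by
    intro j i
    rw [pderiv, fderiv_mollify_apply n h.locInt]
    exact ((EuclideanSpace.proj (𝕜 := ℝ) i).integral_comp_comm (hint j)).symm
  -- The minus sign from differentiating η(x - y) in y is absorbed by the antisymmetry of the curl
  -- when the coordinates are matched below.
  have hq : ∀ (j i k : Fin 3) (y : E3),
      pderiv j i (fun y => mollifier n (x - y) • (EuclideanSpace.single k 1 : E3)) y =
        -fderiv ℝ (mollifier n) (x - y) (EuclideanSpace.single j 1) *
          (EuclideanSpace.single k 1 : E3) i := by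
    intro j i k y
    have hd : DifferentiableAt ℝ (fun y => mollifier n (x - y)) y :=
      ht.1.differentiable (by simp) y
    rw [pderiv, fderiv_smul_const hd]
    by_cases hik : i = k <;> simp [fderiv_mollifier_sub, hik]
  rw [hC]
  fin_cases k
  · simp only [curl, hp, hq, inner_eq_three]
    simp [← integral_sub (hintc _ _) (hintc _ _)]
    refine integral_congr_ae (Eventually.of_forall fun y => ?_)
    simp only
    ring
  · simp only [curl, hp, hq, inner_eq_three]
    simp [← integral_sub (hintc _ _) (hintc _ _)]
    refine integral_congr_ae (Eventually.of_forall fun y => ?_)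
    simp only
    ring
  · simp only [curl, hp, hq, inner_eq_three]
    simp [← integral_sub (hintc _ _) (hintc _ _)]
    refine integral_congr_ae (Eventually.of_forall fun y => ?_)
    simp only
    ring

/-! ### Smooth fields are admissible test fields -/

lemma outerTangentialTrace_of_contDiff (Ω : Set E3) {W : E3 → E3} (hW : ContDiff ℝ 1 W)
    (φ : E3 → E3) : outerTangentialTrace Ω W φ =
      ∫ x in exterior Ω, (inner ℝ (curl W x) (φ x) - inner ℝ (W x) (curl φ x)) := by
  refine integral_congr_ae (ae_restrict_of_ae ?_)
  filter_upwards [(isWeakCurl_curl hW).weakCurl_ae_eq] with x hx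
  rw [hx]

/-- The outer tangential trace depends only on the values in a neighbourhood of `closure Ω`. -/
lemma outerTangentialTrace_congr {Ω : Set E3} {W U φ : E3 → E3} (hW : ContDiff ℝ 1 W)
    (hU : ContDiff ℝ 1 U) (hWU : ∀ x ∈ closure Ω, W =ᶠ[𝓝 x] U) (hφ : IsTestFunction Set.univ φ) :
    outerTangentialTrace Ω W φ = outerTangentialTrace Ω U φ := by
  have hc : ContDiff ℝ 1 φ := hφ.1.of_le (by simp)
  have hint : ∀ {V : E3 → E3}, ContDiff ℝ 1 V →
      Integrable fun x => inner ℝ (curl V x) (φ x) - inner ℝ (V x) (curl φ x) := fun {V} hV =>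
    (integrable_inner_of_locallyIntegrable (continuous_curl hV).locallyIntegrable hc.continuous
      hφ.2.1).sub (integrable_inner_of_locallyIntegrable hV.continuous.locallyIntegrable
      (continuous_curl hc) (hasCompactSupport_curl hφ.2.1))
  rw [outerTangentialTrace_of_contDiff Ω hW, outerTangentialTrace_of_contDiff Ω hU, ← sub_eq_zero,
    ← integral_sub (hint hW).integrableOn (hint hU).integrableOn,
    setIntegral_eq_integral_of_forall_compl_eq_zero]
  · rw [integral_sub (hint hW) (hint hU)]
    -- The integrands for W and U agree on `closure Ω`, so the integral of their difference extends
    -- to all of ℝ³; there Green's formula makes each contribution vanish.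
    have hz : ∀ {V : E3 → E3}, ContDiff ℝ 1 V →
        ∫ x, (inner ℝ (curl V x) (φ x) - inner ℝ (V x) (curl φ x)) = 0 := fun {V} hV => by
      rw [integral_sub (integrable_inner_of_locallyIntegrable
          (continuous_curl hV).locallyIntegrable hc.continuous hφ.2.1)
        (integrable_inner_of_locallyIntegrable hV.continuous.locallyIntegrable
          (continuous_curl hc) (hasCompactSupport_curl hφ.2.1)),
        integral_inner_curl_eq hV hc hφ.2.1, sub_self]
    rw [hz hW, hz hU, sub_zero]
  · intro x hx
    have hx' : x ∈ closure Ω := by simpa [exterior] using hx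
    rw [curl_congr (hWU x hx'), (hWU x hx').eq_of_nhds, sub_self]

lemma memL2Loc_of_continuous {W : E3 → E3} (hW : Continuous W) : MemL2Loc W := fun K hK => by
  have : IsFiniteMeasure (volume.restrict K) := ⟨by simpa using hK.measure_lt_top⟩
  obtain ⟨c, hc⟩ := hK.exists_bound_of_continuousOn hW.continuousOn
  refine MemLp.of_bound hW.aestronglyMeasurable c ?_
  filter_upwards [ae_restrict_mem hK.measurableSet] with x hx using hc x hx

/-- The trace condition only sees W near `closure Ω`, so a compactly supported cutoff of W serves as
the H¹ representative. No growth condition on W itself is required. -/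
lemma memB_of_contDiff {Ω : Set E3} (hΩ : Bornology.IsBounded Ω) (hΩm : MeasurableSet Ω)
    {W : E3 → E3} (hW : ContDiff ℝ 1 W) (hcurl : MemLp (curl W) 2 volume) : MemB Ω W := by
  have hwc := isWeakCurl_curl hW
  have hL2 : MemLp (weakCurl W) 2 volume := hcurl.ae_eq hwc.weakCurl_ae_eq.symm
  refine ⟨⟨memL2Loc_of_continuous hW.continuous, ⟨_, hwc⟩, fun K _ => hL2.restrict K, ?_⟩, hL2, ?_⟩
  · obtain ⟨c, hc⟩ := (hΩ.isCompact_closure).exists_bound_of_continuousOn hW.continuous.continuousOn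
    refine memLp_top_of_bound hW.continuous.aestronglyMeasurable c ?_
    filter_upwards [ae_restrict_mem hΩm] with x hx using hc x (subset_closure hx)
  · obtain ⟨R, hR0, hR⟩ := hΩ.subset_closedBall_lt 0 (0 : E3)
    -- The margin between R and R + 1 makes χ = 1 on a neighbourhood of every point of `closure Ω`,
    -- not merely on the closure.
    let χ : ContDiffBump (0 : E3) := ⟨R + 1, R + 2, by linarith, by linarith⟩
    have hχ : ContDiff ℝ 1 χ := χ.contDiff
    have hU : ContDiff ℝ 1 fun x => χ x • W x := hχ.smul hW
    refine ⟨fun x => χ x • W x, fun i => ?_, fun φ hφ => outerTangentialTrace_congr hW hU ?_ hφ⟩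
    · exact memH1_univ_of_contDiff (contDiff_coord hU i)
        ((χ.hasCompactSupport.smul_right (f' := W)).comp_left (g := fun v : E3 => v i) (by simp))
    · intro x hx
      have hxR : x ∈ Metric.closedBall (0 : E3) R :=
        closure_minimal hR Metric.isClosed_closedBall hx
      have : Metric.ball (0 : E3) (R + 1) ∈ 𝓝 x := Metric.isOpen_ball.mem_nhds
        (Metric.closedBall_subset_ball (by linarith) hxR)
      filter_upwards [this] with y hy
      rw [χ.one_of_mem_closedBall (Metric.ball_subset_closedBall hy), one_smul]

/-! ### Higher integrability of the order parameter -/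

/-- The sublinear truncation `s / (1 + ε s²)`. -/
def trunc (ε s : ℝ) : ℝ := s * (1 + ε * s ^ 2)⁻¹

/-- The derivative of `trunc ε`. -/
def truncDeriv (ε s : ℝ) : ℝ := 2 * (1 + ε * s ^ 2)⁻¹ ^ 2 - (1 + ε * s ^ 2)⁻¹

lemma hasDerivAt_trunc {ε : ℝ} (hε : 0 ≤ ε) (s : ℝ) :
    HasDerivAt (trunc ε) (truncDeriv ε s) s := by
  have hpos : 1 + ε * s ^ 2 ≠ 0 := by positivity
  have h1 : HasDerivAt (fun s : ℝ => 1 + ε * s ^ 2) (ε * (2 * s)) s := by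
    simpa using ((hasDerivAt_pow 2 s).const_mul ε).const_add 1
  have h2 : HasDerivAt (fun s : ℝ => (1 + ε * s ^ 2)⁻¹)
      (-(ε * (2 * s)) / (1 + ε * s ^ 2) ^ 2) s := h1.inv hpos
  have h3 : HasDerivAt (trunc ε) _ s := (hasDerivAt_id s).mul h2
  -- With q = (1 + εs²)⁻¹ one has εs²q = 1 - q, so q - 2εs²q² = 2q² - q.
  refine h3.congr_deriv ?_
  simp only [truncDeriv, id]
  field_simp
  ring

lemma contDiff_trunc {ε : ℝ} (hε : 0 ≤ ε) : ContDiff ℝ 1 (trunc ε) := by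
  refine contDiff_id.mul (ContDiff.inv (by fun_prop) fun s => ?_)
  positivity

lemma inv_one_add_mem {ε : ℝ} (hε : 0 ≤ ε) (s : ℝ) :
    0 < (1 + ε * s ^ 2)⁻¹ ∧ (1 + ε * s ^ 2)⁻¹ ≤ 1 :=
  ⟨by positivity, inv_le_one_of_one_le₀ (by nlinarith [mul_nonneg hε (sq_nonneg s)])⟩

/-- The polynomial 2q² - q stays in [-1, 1] for q in (0, 1]. The bound does not depend on ε, which
is what survives the limit ε → 0. -/
lemma abs_truncDeriv_le {ε : ℝ} (hε : 0 ≤ ε) (s : ℝ) : |truncDeriv ε s| ≤ 1 := by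
  obtain ⟨h1, h2⟩ := inv_one_add_mem hε s
  rw [truncDeriv, abs_le]
  constructor <;> nlinarith

/-- Writing p, q for the two inverses, the difference factors as (2(p + q) - 1)(p - q). The first
factor is at most 3 in absolute value; the second is at most 2|s - t|, because ε|r| ≤ 1 + εr² when ε
≤ 1. -/
lemma abs_truncDeriv_sub_le {ε : ℝ} (hε : 0 ≤ ε) (hε1 : ε ≤ 1) (s t : ℝ) :
    |truncDeriv ε s - truncDeriv ε t| ≤ 6 * |s - t| := by
  obtain ⟨hs1, hs2⟩ := inv_one_add_mem hε s
  obtain ⟨ht1, ht2⟩ := inv_one_add_mem hε t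
  have hb : ∀ r : ℝ, ε * |r| * (1 + ε * r ^ 2)⁻¹ ≤ 1 := fun r => by
    rw [← div_eq_mul_inv, div_le_one (by positivity), ← sq_abs]
    nlinarith [mul_nonneg hε (sq_nonneg (|r| - 1)), mul_nonneg hε (sq_nonneg |r|)]
  have hbs := hb s
  have hbt := hb t
  have hds : (1 + ε * s ^ 2) ≠ 0 := by positivity
  have hdt : (1 + ε * t ^ 2) ≠ 0 := by positivity
  have hsub : (1 + ε * s ^ 2)⁻¹ - (1 + ε * t ^ 2)⁻¹ =
      ε * (t + s) * (1 + ε * s ^ 2)⁻¹ * (1 + ε * t ^ 2)⁻¹ * (t - s) := by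
    field_simp
    ring
  have hq : |(1 + ε * s ^ 2)⁻¹ - (1 + ε * t ^ 2)⁻¹| ≤ 2 * |s - t| := by
    rw [hsub, abs_mul, abs_sub_comm t s]
    gcongr
    rw [abs_mul, abs_mul, abs_mul, abs_of_nonneg hε, abs_of_pos hs1, abs_of_pos ht1]
    set p := (1 + ε * s ^ 2)⁻¹
    set q := (1 + ε * t ^ 2)⁻¹
    calc ε * |t + s| * p * q ≤ ε * (|t| + |s|) * p * q := by gcongr; exact abs_add_le t s
      _ = (ε * |t| * q) * p + (ε * |s| * p) * q := by ring
      _ ≤ 1 * 1 + 1 * 1 := by gcongr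
      _ = 2 := by norm_num
  simp only [truncDeriv]
  set p := (1 + ε * s ^ 2)⁻¹
  set q := (1 + ε * t ^ 2)⁻¹
  have hfac : 2 * p ^ 2 - p - (2 * q ^ 2 - q) = (2 * (p + q) - 1) * (p - q) := by ring
  have h3 : |2 * (p + q) - 1| ≤ 3 := by rw [abs_le]; constructor <;> linarith
  rw [hfac, abs_mul]
  calc |2 * (p + q) - 1| * |p - q| ≤ 3 * (2 * |s - t|) := by gcongr
    _ = 6 * |s - t| := by ring

lemma memB_zero {Ω : Set E3} (hΩ : Bornology.IsBounded Ω) (hΩm : MeasurableSet Ω) :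
    MemB Ω fun _ => 0 := by
  refine memB_of_contDiff hΩ hΩm contDiff_const ?_
  rw [funext curl_zero]
  exact MemLp.zero'

lemma weakCurl_zero : weakCurl (fun _ => 0) =ᵐ[volume] fun _ => 0 := by
  have := (isWeakCurl_curl (W := fun _ => 0) contDiff_const).weakCurl_ae_eq
  rwa [funext curl_zero] at this

lemma MemA.exists_norm_le {Ω : Set E3} {A : E3 → E3} (h : MemA Ω A) :
    ∃ K : ℝ, 0 ≤ K ∧ ∀ᵐ x ∂volume.restrict Ω, ‖A x‖ ≤ K := by
  refine ⟨(eLpNorm A ⊤ (volume.restrict Ω)).toReal, ENNReal.toReal_nonneg, ?_⟩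
  filter_upwards [enorm_ae_le_eLpNormEssSup A (volume.restrict Ω)] with x hx
  rw [← eLpNorm_exponent_top] at hx
  simpa using ENNReal.toReal_mono h.bounded.2.ne hx

variable {Ω : Set E3} {lam κ : ℝ} {H : E3 → E3} {f : E3 → ℝ} {A : E3 → E3}

/-- The energy estimate obtained by testing with a sublinear truncation of `f`. -/
lemma IsWeakSolution.integral_trunc_le (hΩo : IsOpen Ω) (hΩb : Bornology.IsBounded Ω)
    (h : IsWeakSolution Ω lam κ H f A) {ε : ℝ} (hε : 0 < ε) (hε1 : ε ≤ 1) :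
    IntegrableOn (fun x => f x ^ 4 * (1 + ε * f x ^ 2)⁻¹) Ω ∧
      ∫ x in Ω, f x ^ 4 * (1 + ε * f x ^ 2)⁻¹ ≤
        ∫ x in Ω, (f x ^ 2 + lam ^ 2 / κ ^ 2 * ‖weakGrad Ω f x‖ ^ 2) := by
  have hf := h.memH1.memLp
  have hG := h.memH1.memLp_weakGrad
  have hgrad : IsWeakGrad Ω (fun x => trunc ε (f x))
      (fun x => truncDeriv ε (f x) • weakGrad Ω f x) :=
    h.memH1.isWeakGrad.comp hΩo hf hG (contDiff_trunc hε.le) (hasDerivAt_trunc hε.le)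
      (by simp [trunc]) (abs_truncDeriv_le hε.le) (abs_truncDeriv_sub_le hε.le hε1)
  have hfm := hf.1
  have hq : AEStronglyMeasurable (fun x => (1 + ε * f x ^ 2)⁻¹) (volume.restrict Ω) := by
    have : Continuous fun s : ℝ => (1 + ε * s ^ 2)⁻¹ :=
      Continuous.inv₀ (by fun_prop) fun s => by positivity
    exact this.comp_aestronglyMeasurable hfm
  have htm : AEStronglyMeasurable (fun x => truncDeriv ε (f x)) (volume.restrict Ω) := by
    unfold truncDeriv
    exact ((hq.pow 2).const_mul 2).sub hq
  have hg : MemH1 Ω fun x => trunc ε (f x) := by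
    refine hgrad.memH1 hΩo ?_ ?_
    · refine hf.of_le (hfm.mul hq) (Eventually.of_forall fun x => ?_)
      obtain ⟨h1, h2⟩ := inv_one_add_mem hε.le (f x)
      rw [trunc, norm_mul, Real.norm_of_nonneg h1.le]
      exact mul_le_of_le_one_right (norm_nonneg _) h2
    · refine hG.of_le (htm.smul hG.1) (Eventually.of_forall fun x => ?_)
      rw [norm_smul]
      exact mul_le_of_le_one_left (norm_nonneg _) (abs_truncDeriv_le hε.le _)
  have hf2 : IntegrableOn (fun x => f x ^ 2) Ω := hf.integrable_sq
  have hG2 : IntegrableOn (fun x => ‖weakGrad Ω f x‖ ^ 2) Ω := hG.integrable_norm_pow (by norm_num)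
  obtain ⟨K, hK0, hK⟩ := h.memA.exists_norm_le
  have hAm : AEStronglyMeasurable A (volume.restrict Ω) := h.memA.bounded.1
  -- For fixed ε the quartic term is dominated by ε⁻¹f², so the tested equation can be split before
  -- f ∈ L⁴ is known.
  have iR : IntegrableOn (fun x => f x ^ 4 * (1 + ε * f x ^ 2)⁻¹) Ω := by
    refine (hf2.const_mul ε⁻¹).mono' ((hfm.pow 4).mul hq) (Eventually.of_forall fun x => ?_)
    have hpos : 0 < 1 + ε * f x ^ 2 := by positivity
    rw [Real.norm_of_nonneg (by positivity), ← div_eq_mul_inv, div_le_iff₀ hpos]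
    have : ε⁻¹ * f x ^ 2 * (1 + ε * f x ^ 2) = ε⁻¹ * f x ^ 2 + f x ^ 4 := by
      field_simp
    rw [this]
    have : 0 ≤ ε⁻¹ * f x ^ 2 := by positivity
    linarith
  have iP : IntegrableOn
      (fun x => lam ^ 2 / κ ^ 2 * (truncDeriv ε (f x) * ‖weakGrad Ω f x‖ ^ 2)) Ω := by
    refine Integrable.const_mul (hG2.mono' (htm.mul (hG.1.norm.pow 2))
      (Eventually.of_forall fun x => ?_)) _
    rw [Pi.mul_apply, Pi.pow_apply, norm_mul, norm_pow, norm_norm]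
    exact mul_le_of_le_one_left (by positivity) (abs_truncDeriv_le hε.le _)
  have iQ : IntegrableOn (fun x => (1 - ‖A x‖ ^ 2) * (f x ^ 2 * (1 + ε * f x ^ 2)⁻¹)) Ω := by
    refine (hf2.const_mul (1 + K ^ 2)).mono'
      ((aestronglyMeasurable_const.sub (hAm.norm.pow 2)).mul ((hfm.pow 2).mul hq)) ?_
    filter_upwards [hK] with x hx
    obtain ⟨h1, h2⟩ := inv_one_add_mem hε.le (f x)
    rw [norm_mul, norm_mul, Real.norm_of_nonneg h1.le, Real.norm_of_nonneg (sq_nonneg (f x))]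
    have hA2 : ‖A x‖ ^ 2 ≤ K ^ 2 := by gcongr
    have hA0 := sq_nonneg ‖A x‖
    gcongr
    · rw [Real.norm_eq_abs, abs_le]
      constructor <;> linarith
    · exact mul_le_of_le_one_right (sq_nonneg _) h2
  refine ⟨iR, ?_⟩
  -- The choice B = 0 isolates the scalar equation.
  have heq := h.weak_eq _ _ hg (memB_zero hΩb hΩo.measurableSet)
  have hz : ∫ x, lam * inner ℝ (lam • weakCurl A x - H x) (weakCurl (fun _ => 0) x) = 0 := by
    refine integral_eq_zero_of_ae ?_
    filter_upwards [weakCurl_zero] with x hx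
    simp [hx]
  rw [hz, add_zero] at heq
  have hsplit : ∫ x in Ω, (lam ^ 2 / κ ^ 2 * (truncDeriv ε (f x) * ‖weakGrad Ω f x‖ ^ 2)
      - (1 - ‖A x‖ ^ 2) * (f x ^ 2 * (1 + ε * f x ^ 2)⁻¹)
      + f x ^ 4 * (1 + ε * f x ^ 2)⁻¹) = 0 := by
    rw [← heq]
    refine integral_congr_ae ?_
    filter_upwards [hgrad.weakGrad_ae_eq hΩo] with x hx
    rw [hx, inner_smul_right, real_inner_self_eq_norm_sq, inner_zero_right, trunc]
    ring
  have iPQ : IntegrableOn (fun x => lam ^ 2 / κ ^ 2 * (truncDeriv ε (f x) * ‖weakGrad Ω f x‖ ^ 2)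
      - (1 - ‖A x‖ ^ 2) * (f x ^ 2 * (1 + ε * f x ^ 2)⁻¹)) Ω := iP.sub iQ
  rw [integral_add iPQ iR] at hsplit
  have hR : ∫ x in Ω, f x ^ 4 * (1 + ε * f x ^ 2)⁻¹ =
      ∫ x in Ω, -(lam ^ 2 / κ ^ 2 * (truncDeriv ε (f x) * ‖weakGrad Ω f x‖ ^ 2)
      - (1 - ‖A x‖ ^ 2) * (f x ^ 2 * (1 + ε * f x ^ 2)⁻¹)) := by
    rw [integral_neg]
    linarith
  rw [hR]
  -- The term with |A|² has a favourable sign and is dropped; the others are bounded uniformly in ε.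
  refine integral_mono iPQ.neg (hf2.add (hG2.const_mul _)) fun x => ?_
  obtain ⟨h1, h2⟩ := inv_one_add_mem hε.le (f x)
  have h3 := (abs_le.1 (abs_truncDeriv_le hε.le (f x))).1
  have hc : 0 ≤ lam ^ 2 / κ ^ 2 := by positivity
  have e1 : -(lam ^ 2 / κ ^ 2 * (truncDeriv ε (f x) * ‖weakGrad Ω f x‖ ^ 2)) ≤
      lam ^ 2 / κ ^ 2 * ‖weakGrad Ω f x‖ ^ 2 := by
    rw [← mul_neg]
    gcongr
    nlinarith [sq_nonneg ‖weakGrad Ω f x‖]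
  have e2 : (1 - ‖A x‖ ^ 2) * (f x ^ 2 * (1 + ε * f x ^ 2)⁻¹) ≤ f x ^ 2 := by
    have i1 : 0 ≤ f x ^ 2 * (1 + ε * f x ^ 2)⁻¹ := by positivity
    have i2 : f x ^ 2 * (1 + ε * f x ^ 2)⁻¹ ≤ f x ^ 2 := mul_le_of_le_one_right (sq_nonneg _) h2
    nlinarith [mul_nonneg (sq_nonneg ‖A x‖) i1]
  simp only
  linarith

/-- The order parameter of a weak solution belongs to `L⁴(Ω)`. -/
lemma IsWeakSolution.memLp_sq (hΩo : IsOpen Ω) (hΩb : Bornology.IsBounded Ω)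
    (h : IsWeakSolution Ω lam κ H f A) : MemLp (fun x => f x ^ 2) 2 (volume.restrict Ω) := by
  have hfm := h.memH1.memLp.1
  refine (memLp_two_iff_integrable_sq (f := fun x => f x ^ 2) (hfm.pow 2)).2 ?_
  have hpow : ∀ x, (f x ^ 2) ^ 2 = f x ^ 4 := fun x => by ring
  simp_rw [hpow]
  refine ⟨hfm.pow 4, ?_⟩
  set K := ∫ x in Ω, (f x ^ 2 + lam ^ 2 / κ ^ 2 * ‖weakGrad Ω f x‖ ^ 2)
  set ε : ℕ → ℝ := fun n => 1 / ((n : ℝ) + 1) with hε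
  have hε0 : ∀ n, 0 < ε n := fun n => by positivity
  have hε1 : ∀ n, ε n ≤ 1 := fun n => by
    rw [hε]
    exact (div_le_one (by positivity)).2 (by linarith [(Nat.cast_nonneg n : (0 : ℝ) ≤ n)])
  have hlim : ∀ x, Tendsto (fun n => ENNReal.ofReal (f x ^ 4 * (1 + ε n * f x ^ 2)⁻¹)) atTop
      (𝓝 (ENNReal.ofReal (f x ^ 4))) := fun x => by
    refine (ENNReal.continuous_ofReal.tendsto _).comp ?_
    have h1 : Tendsto (fun n => 1 + ε n * f x ^ 2) atTop (𝓝 (1 + 0 * f x ^ 2)) :=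
      (tendsto_one_div_add_atTop_nhds_zero_nat.mul_const _).const_add _
    simpa using (h1.inv₀ (by simp)).const_mul (f x ^ 4)
  have hpos : ∀ n x, 0 ≤ f x ^ 4 * (1 + ε n * f x ^ 2)⁻¹ := fun n x => by
    have := (hε0 n).le
    positivity
  have hle : ∀ n, ∫⁻ x in Ω, ENNReal.ofReal (f x ^ 4 * (1 + ε n * f x ^ 2)⁻¹) ≤
      ENNReal.ofReal K := fun n => by
    obtain ⟨hi, hb⟩ := h.integral_trunc_le hΩo hΩb (hε0 n) (hε1 n)
    rw [← ofReal_integral_eq_lintegral_ofReal hi (Eventually.of_forall (hpos n))]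
    exact ENNReal.ofReal_le_ofReal hb
  rw [hasFiniteIntegral_iff_ofReal (Eventually.of_forall fun x => (by positivity : 0 ≤ f x ^ 4))]
  -- Fatou's lemma along ε = 1/(n + 1), with the right-hand side of the energy estimate independent
  -- of n.
  calc ∫⁻ x in Ω, ENNReal.ofReal (f x ^ 4)
      = ∫⁻ x in Ω, liminf (fun n => ENNReal.ofReal (f x ^ 4 * (1 + ε n * f x ^ 2)⁻¹)) atTop :=
        lintegral_congr fun x => (hlim x).liminf_eq.symm
    _ ≤ liminf (fun n => ∫⁻ x in Ω, ENNReal.ofReal (f x ^ 4 * (1 + ε n * f x ^ 2)⁻¹)) atTop :=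
        lintegral_liminf_le' fun n =>
          (h.integral_trunc_le hΩo hΩb (hε0 n)
            (hε1 n)).1.aestronglyMeasurable.aemeasurable.ennreal_ofReal
    _ ≤ liminf (fun _ : ℕ => ENNReal.ofReal K) atTop :=
        liminf_le_liminf (Eventually.of_forall hle)
    _ < ⊤ := by simp

/-! ### Strict monotonicity of the potential -/

section Monotone

variable {E : Type*} [NormedAddCommGroup E] [InnerProductSpace ℝ E]

/-- The increment of the gradient of `(1 - f²)² / 4 + f² |A|² / 2` between `(f₀, A₀)` and
`(f₁, A₁)`, paired with `(f₁ - f₀, A₁ - A₀)`. -/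
def gradDiff (f₀ f₁ : ℝ) (A₀ A₁ : E) : ℝ :=
  -((1 - f₁ ^ 2 - ‖A₁‖ ^ 2) * f₁ * (f₁ - f₀)) + (1 - f₀ ^ 2 - ‖A₀‖ ^ 2) * f₀ * (f₁ - f₀)
    + inner ℝ (f₁ ^ 2 • A₁) (A₁ - A₀) - inner ℝ (f₀ ^ 2 • A₀) (A₁ - A₀)

/-- The set `f > 0`, `f² - |A|² > 1/3` is closed under midpoints. -/
lemma midpoint_condition {E : Type*} [NormedAddCommGroup E] {f₀ f₁ : ℝ} {A₀ A₁ : E}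
    (hf₀ : 0 < f₀) (hf₁ : 0 < f₁)
    (h₀ : 1 / 3 < f₀ ^ 2 - ‖A₀‖ ^ 2) (h₁ : 1 / 3 < f₁ ^ 2 - ‖A₁‖ ^ 2) :
    4 / 3 < (f₀ + f₁) ^ 2 - ‖A₀ + A₁‖ ^ 2 := by
  have hn : ‖A₀ + A₁‖ ^ 2 ≤ (‖A₀‖ + ‖A₁‖) ^ 2 := by gcongr; exact norm_add_le _ _
  have ha := norm_nonneg A₀
  have hb := norm_nonneg A₁
  generalize ‖A₀‖ = a at *
  generalize ‖A₁‖ = b at *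
  -- A reversed Cauchy–Schwarz inequality: (1/3 + ab)² ≤ (1/3 + a²)(1/3 + b²) < f₀²f₁². Then (f₀ +
  -- f₁)² - (a + b)² exceeds 1/3 + 1/3 + 2 · 1/3.
  have hprod : (1 / 3 + a * b) < f₀ * f₁ := by
    refine lt_of_pow_lt_pow_left₀ 2 (by positivity) ?_
    have : (1 / 3 + a ^ 2) * (1 / 3 + b ^ 2) < f₀ ^ 2 * f₁ ^ 2 := by
      gcongr <;> linarith
    nlinarith [sq_nonneg (a - b)]
  nlinarith

/-- The exact midpoint expansion of `gradDiff`. -/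
lemma gradDiff_eq (f₀ f₁ : ℝ) (A₀ A₁ : E) :
    gradDiff f₀ f₁ A₀ A₁ =
      (3 / 4 * (f₀ + f₁) ^ 2 - 1 + ‖A₀ + A₁‖ ^ 2 / 4) * (f₁ - f₀) ^ 2
      + (f₀ + f₁) * (f₁ - f₀) * inner ℝ (A₀ + A₁) (A₁ - A₀)
      + (f₀ + f₁) ^ 2 / 4 * ‖A₁ - A₀‖ ^ 2
      + (f₁ - f₀) ^ 4 / 4 + (f₁ - f₀) ^ 2 * ‖A₁ - A₀‖ ^ 2 / 2 := by
  have e1 := norm_add_sq_real A₀ A₁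
  have e2 := norm_sub_sq_real A₁ A₀
  have e3 := real_inner_comm A₀ A₁
  simp only [gradDiff, inner_smul_left, inner_sub_right, inner_add_left,
    real_inner_self_eq_norm_sq, e1, e2, e3, conj_trivial]
  ring

/-- Completing the square spends all of the |A₁ - A₀|² term of the midpoint Hessian on the cross
term. What remains is its Schur complement, 3(m² - |M|²) - 1 at the midpoint (m, M); the quartic
remainder is discarded. -/
lemma gradDiff_lower_bound (f₀ f₁ : ℝ) (A₀ A₁ : E) (hf : 0 ≤ f₀ + f₁) :
    (3 * ((f₀ + f₁) ^ 2 - ‖A₀ + A₁‖ ^ 2) / 4 - 1) * (f₁ - f₀) ^ 2 ≤ gradDiff f₀ f₁ A₀ A₁ := by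
  have hin := abs_real_inner_le_norm (A₀ + A₁) (A₁ - A₀)
  have h1 : -((f₀ + f₁) * |f₁ - f₀| * (‖A₀ + A₁‖ * ‖A₁ - A₀‖)) ≤
      (f₀ + f₁) * (f₁ - f₀) * inner ℝ (A₀ + A₁) (A₁ - A₀) := by
    refine neg_le_of_abs_le ?_
    rw [abs_mul, abs_mul, abs_of_nonneg hf]
    gcongr
  rw [gradDiff_eq]
  have h2 := sq_nonneg (‖A₀ + A₁‖ * |f₁ - f₀| - (f₀ + f₁) / 2 * ‖A₁ - A₀‖)
  have h3 : |f₁ - f₀| ^ 2 = (f₁ - f₀) ^ 2 := sq_abs _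
  have h4 : 0 ≤ (f₁ - f₀) ^ 4 / 4 := by positivity
  have h5 : 0 ≤ (f₁ - f₀) ^ 2 * ‖A₁ - A₀‖ ^ 2 / 2 := by positivity
  have h6 : (‖A₀ + A₁‖ * |f₁ - f₀| - (f₀ + f₁) / 2 * ‖A₁ - A₀‖) ^ 2 =
      ‖A₀ + A₁‖ ^ 2 * (f₁ - f₀) ^ 2 - (f₀ + f₁) * |f₁ - f₀| * (‖A₀ + A₁‖ * ‖A₁ - A₀‖)
        + (f₀ + f₁) ^ 2 / 4 * ‖A₁ - A₀‖ ^ 2 := by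
    rw [← h3]; ring
  rw [h6] at h2
  linarith

lemma gradDiff_nonneg {f₀ f₁ : ℝ} {A₀ A₁ : E} (hf₀ : 0 < f₀) (hf₁ : 0 < f₁)
    (h₀ : 1 / 3 < f₀ ^ 2 - ‖A₀‖ ^ 2) (h₁ : 1 / 3 < f₁ ^ 2 - ‖A₁‖ ^ 2) :
    0 ≤ gradDiff f₀ f₁ A₀ A₁ := by
  have := midpoint_condition hf₀ hf₁ h₀ h₁
  refine le_trans (mul_nonneg ?_ (sq_nonneg _)) (gradDiff_lower_bound f₀ f₁ A₀ A₁ (by positivity))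
  linarith

/-- The strictly positive Schur complement forces f₁ = f₀. Only f₁²|A₁ - A₀|² is then left in the
expansion, and f₁ > 0. -/
lemma eq_of_gradDiff_eq_zero {f₀ f₁ : ℝ} {A₀ A₁ : E} (hf₀ : 0 < f₀) (hf₁ : 0 < f₁)
    (h₀ : 1 / 3 < f₀ ^ 2 - ‖A₀‖ ^ 2) (h₁ : 1 / 3 < f₁ ^ 2 - ‖A₁‖ ^ 2)
    (h : gradDiff f₀ f₁ A₀ A₁ = 0) : f₀ = f₁ ∧ A₀ = A₁ := by
  have hm := midpoint_condition hf₀ hf₁ h₀ h₁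
  have hl := gradDiff_lower_bound f₀ f₁ A₀ A₁ (by positivity)
  rw [h] at hl
  have hg : (f₁ - f₀) ^ 2 = 0 := by
    refine le_antisymm ?_ (sq_nonneg _)
    by_contra hne
    have : 0 < (3 * ((f₀ + f₁) ^ 2 - ‖A₀ + A₁‖ ^ 2) / 4 - 1) * (f₁ - f₀) ^ 2 :=
      mul_pos (by linarith) (not_le.1 hne)
    linarith
  have hff : f₁ = f₀ := sub_eq_zero.1 (pow_eq_zero_iff (by norm_num) |>.1 hg)
  subst hff
  rw [gradDiff_eq] at h
  have hA : f₁ ^ 2 * ‖A₁ - A₀‖ ^ 2 = 0 := by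
    have : (f₁ + f₁) ^ 2 / 4 = f₁ ^ 2 := by ring
    simpa [this] using h
  have : ‖A₁ - A₀‖ = 0 := by
    rcases mul_eq_zero.1 hA with h' | h'
    · exact absurd h' (by positivity)
    · exact pow_eq_zero_iff (by norm_num) |>.1 h'
  exact ⟨rfl, (sub_eq_zero.1 (norm_eq_zero.1 this)).symm⟩

end Monotone

/-! ### Uniqueness -/

lemma integrable_inner_of_memLp_two {X E : Type*} [MeasurableSpace X] {μ : Measure X}
    [NormedAddCommGroup E] [InnerProductSpace ℝ E] {u v : X → E} (hu : MemLp u 2 μ)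
    (hv : MemLp v 2 μ) : Integrable (fun x => inner ℝ (u x) (v x)) μ := by
  refine (L2.integrable_inner (𝕜 := ℝ) (hu.toLp u) (hv.toLp v)).congr ?_
  filter_upwards [hu.coeFn_toLp, hv.coeFn_toLp] with x h1 h2
  rw [h1, h2]

/-- The weak equation extends to test fields without any condition on the tangential trace. -/
lemma IsWeakSolution.weak_eq_of_isWeakCurl (hΩo : IsOpen Ω) (hΩb : Bornology.IsBounded Ω)
    (hlam : lam ≠ 0) (h : IsWeakSolution Ω lam κ H f A) {g : E3 → ℝ} (hg : MemH1 Ω g)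
    (hfg : MemLp (fun x => f x * g x) 2 (volume.restrict Ω)) {B C : E3 → E3}
    (hB : MemL2Loc B) (hBC : IsWeakCurl B C) (hC : MemLp C 2 volume) :
    IntegrableOn (fun x => lam ^ 2 / κ ^ 2 * inner ℝ (weakGrad Ω f x) (weakGrad Ω g x)
        - (1 - f x ^ 2 - ‖A x‖ ^ 2) * f x * g x) Ω ∧
    IntegrableOn (fun x => inner ℝ (f x ^ 2 • A x) (B x)) Ω ∧
    Integrable (fun x => inner ℝ (lam • weakCurl A x - H x) (C x)) ∧
    (∫ x in Ω, (lam ^ 2 / κ ^ 2 * inner ℝ (weakGrad Ω f x) (weakGrad Ω g x)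
        - (1 - f x ^ 2 - ‖A x‖ ^ 2) * f x * g x))
      + (∫ x in Ω, inner ℝ (f x ^ 2 • A x) (B x))
      + lam * ∫ x, inner ℝ (lam • weakCurl A x - H x) (C x) = 0 := by
  have : IsFiniteMeasure (volume.restrict Ω) := ⟨by simpa using hΩb.measure_lt_top⟩
  obtain ⟨K, hK0, hK⟩ := h.memA.exists_norm_le
  have hAm : AEStronglyMeasurable A (volume.restrict Ω) := h.memA.bounded.1
  have hf2 := h.memLp_sq hΩo hΩb
  have hA2 : MemLp (fun x => ‖A x‖ ^ 2) 2 (volume.restrict Ω) := by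
    refine MemLp.of_bound (hAm.norm.pow 2) (K ^ 2) ?_
    filter_upwards [hK] with x hx
    rw [norm_pow, norm_norm]
    gcongr
  have hS : MemLp (fun x => 1 - f x ^ 2 - ‖A x‖ ^ 2) 2 (volume.restrict Ω) :=
    ((memLp_const 1).sub hf2).sub hA2
  have iS : IntegrableOn (fun x => (1 - f x ^ 2 - ‖A x‖ ^ 2) * f x * g x) Ω := by
    simp_rw [mul_assoc]
    exact hS.integrable_mul hfg
  have i1 : IntegrableOn (fun x => lam ^ 2 / κ ^ 2 * inner ℝ (weakGrad Ω f x) (weakGrad Ω g x)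
      - (1 - f x ^ 2 - ‖A x‖ ^ 2) * f x * g x) Ω :=
    ((integrable_inner_of_memLp_two h.memH1.memLp_weakGrad hg.memLp_weakGrad).const_mul _).sub iS
  -- Here f ∈ L⁴ is essential: f² is in L² and A is bounded, so B enters through a continuous L²
  -- pairing.
  have hfA : MemLp (fun x => f x ^ 2 • A x) 2 (volume.restrict Ω) := by
    refine hf2.of_le_mul (c := K) (hf2.1.smul hAm) ?_
    filter_upwards [hK] with x hx
    rw [norm_smul, mul_comm]
    gcongr
  have hBΩ : MemLp B 2 (volume.restrict Ω) :=
    (hB _ hΩb.isCompact_closure).mono_measure (Measure.restrict_mono subset_closure le_rfl)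
  have hH : MemLp (fun x => lam • weakCurl A x - H x) 2 volume := by
    refine (h.memA.memLp_sub.const_smul lam).ae_eq (Eventually.of_forall fun x => ?_)
    simp [smul_sub, smul_smul, hlam]
  -- Mollified fields are admissible because their curl is the mollification of C, hence in L².
  have hsm : ∀ n, ContDiff ℝ 1 (mollify n B) := fun n =>
    (mollify_contDiff n hBC.locInt).of_le (by simp)
  have hcurl : ∀ n, MemLp (curl (mollify n B)) 2 volume := fun n => by
    rw [hBC.curl_mollify]
    exact memLp_mollify n hC
  have hBn : ∀ n, MemLp (mollify n B) 2 (volume.restrict Ω) := fun n =>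
    (memL2Loc_of_continuous (hsm n).continuous _ hΩb.isCompact_closure).mono_measure
      (Measure.restrict_mono subset_closure le_rfl)
  have T1 := tendsto_integral_inner_of_tendsto_eLpNorm_right hfA hBΩ hBn
    (tendsto_eLpNorm_mollify_sub_restrict hB hΩb)
  have T2 := tendsto_integral_inner_of_tendsto_eLpNorm_right hH hC (fun n => memLp_mollify n hC)
    (tendsto_eLpNorm_mollify_sub hC)
  refine ⟨i1, integrable_inner_of_memLp_two hfA hBΩ, integrable_inner_of_memLp_two hH hC, ?_⟩
  refine tendsto_nhds_unique ((T1.const_add _).add (T2.const_mul lam))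
    (tendsto_const_nhds.congr fun n => ?_)
  have heq := h.weak_eq g (mollify n B) hg
    (memB_of_contDiff hΩb hΩo.measurableSet (hsm n) (hcurl n))
  rw [← heq]
  congr 1
  · rw [← integral_add i1 (integrable_inner_of_memLp_two hfA (hBn n))]
    simp_rw [real_inner_smul_left]
  · rw [← integral_const_mul]
    refine integral_congr_ae ?_
    filter_upwards [(isWeakCurl_curl (hsm n)).weakCurl_ae_eq] with x hx
    rw [hx, hBC.curl_mollify]

/-- Two weak Meissner solutions satisfying the stability condition have the same order parameter
and the same magnetic potential in `Ω`, and the same magnetic field everywhere. -/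
lemma IsWeakMeissnerSolution.unique (hΩo : IsOpen Ω) (hΩb : Bornology.IsBounded Ω)
    (hlam : 0 < lam) {f₀ f₁ : E3 → ℝ} {A₀ A₁ : E3 → E3}
    (h₀ : IsWeakMeissnerSolution Ω lam κ H f₀ A₀) (h₁ : IsWeakMeissnerSolution Ω lam κ H f₁ A₁)
    (hs₀ : StabilityCondition Ω f₀ A₀) (hs₁ : StabilityCondition Ω f₁ A₁) :
    (∀ᵐ x ∂volume.restrict Ω, f₀ x = f₁ x ∧ A₀ x = A₁ x) ∧
      weakCurl A₀ =ᵐ[volume] weakCurl A₁ := by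
  have hgrad := h₁.memH1.isWeakGrad.sub h₀.memH1.isWeakGrad
  have hg := hgrad.memH1 hΩo (h₁.memH1.memLp.sub h₀.memH1.memLp)
    (h₁.memH1.memLp_weakGrad.sub h₀.memH1.memLp_weakGrad)
  have hsq₀ := h₀.toIsWeakSolution.memLp_sq hΩo hΩb
  have hsq₁ := h₁.toIsWeakSolution.memLp_sq hΩo hΩb
  have hm₀ := h₀.memH1.memLp.1
  have hm₁ := h₁.memH1.memLp.1
  -- Since |f₀f₁| ≤ (f₀² + f₁²)/2, the product is dominated by squares that lie in L².
  have hfg₀ : MemLp (fun x => f₀ x * (f₁ x - f₀ x)) 2 (volume.restrict Ω) := by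
    refine ((hsq₀.const_mul 2).add hsq₁).of_le (hm₀.mul (hm₁.sub hm₀))
      (Eventually.of_forall fun x => ?_)
    simp only [Pi.add_apply, Real.norm_eq_abs]
    rw [abs_of_nonneg (a := 2 * f₀ x ^ 2 + f₁ x ^ 2) (by positivity), abs_le]
    constructor <;> nlinarith [sq_nonneg (f₀ x - f₁ x), sq_nonneg (f₀ x + f₁ x), sq_nonneg (f₀ x)]
  have hfg₁ : MemLp (fun x => f₁ x * (f₁ x - f₀ x)) 2 (volume.restrict Ω) := by
    refine ((hsq₁.const_mul 2).add hsq₀).of_le (hm₁.mul (hm₁.sub hm₀))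
      (Eventually.of_forall fun x => ?_)
    simp only [Pi.add_apply, Real.norm_eq_abs]
    rw [abs_of_nonneg (a := 2 * f₁ x ^ 2 + f₀ x ^ 2) (by positivity), abs_le]
    constructor <;> nlinarith [sq_nonneg (f₀ x - f₁ x), sq_nonneg (f₀ x + f₁ x), sq_nonneg (f₁ x)]
  have hcurl := (isWeakCurl_weakCurl h₁.memA.exists_weakCurl).sub
    (isWeakCurl_weakCurl h₀.memA.exists_weakCurl)
  have hB : MemL2Loc fun x => A₁ x - A₀ x := fun K hK =>
    (h₁.memA.memL2Loc K hK).sub (h₀.memA.memL2Loc K hK)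
  -- Neither curl need be in L² by itself; the common field λ⁻¹H cancels in the difference.
  have hC : MemLp (fun x => weakCurl A₁ x - weakCurl A₀ x) 2 volume := by
    refine (h₁.memA.memLp_sub.sub h₀.memA.memLp_sub).ae_eq
      (Eventually.of_forall fun x => ?_)
    simp
  obtain ⟨i₀, j₀, k₀, e₀⟩ := h₀.toIsWeakSolution.weak_eq_of_isWeakCurl hΩo hΩb hlam.ne' hg hfg₀
    hB hcurl hC
  obtain ⟨i₁, j₁, k₁, e₁⟩ := h₁.toIsWeakSolution.weak_eq_of_isWeakCurl hΩo hΩb hlam.ne' hg hfg₁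
    hB hcurl hC
  obtain ⟨c₀, hc₀, hp₀⟩ := h₀.pos
  obtain ⟨c₁, hc₁, hp₁⟩ := h₁.pos
  obtain ⟨d₀, hd₀, hq₀⟩ := hs₀
  obtain ⟨d₁, hd₁, hq₁⟩ := hs₁
  -- The equation for (f₁, A₁) minus the one for (f₀, A₀), both tested with the same differences; H
  -- drops out.
  have hX : (∫ x in Ω, (lam ^ 2 / κ ^ 2 * ‖weakGrad Ω f₁ x - weakGrad Ω f₀ x‖ ^ 2
      + gradDiff (f₀ x) (f₁ x) (A₀ x) (A₁ x)))
      + lam ^ 2 * ∫ x, ‖weakCurl A₁ x - weakCurl A₀ x‖ ^ 2 = 0 := by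
    have hΩeq : ∫ x in Ω, (lam ^ 2 / κ ^ 2 * ‖weakGrad Ω f₁ x - weakGrad Ω f₀ x‖ ^ 2
        + gradDiff (f₀ x) (f₁ x) (A₀ x) (A₁ x)) = _ :=
      Eq.trans (integral_congr_ae (by
        filter_upwards [hgrad.weakGrad_ae_eq hΩo] with x hx
        rw [← real_inner_self_eq_norm_sq]
        simp only [Pi.add_apply, hx, gradDiff, inner_sub_left]
        ring)) (integral_sub (i₁.add j₁) (i₀.add j₀))
    have hceq : ∫ x, lam * ‖weakCurl A₁ x - weakCurl A₀ x‖ ^ 2 = _ :=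
      Eq.trans (integral_congr_ae (Eventually.of_forall fun x => by
        simp only [← real_inner_self_eq_norm_sq, inner_sub_left, real_inner_smul_left]
        ring)) (integral_sub k₁ k₀)
    rw [integral_const_mul] at hceq
    rw [integral_add' i₁ j₁, integral_add' i₀ j₀] at hΩeq
    linear_combination hΩeq + lam * hceq + e₁ - e₀
  have hN : 0 ≤ᵐ[volume.restrict Ω] fun x => gradDiff (f₀ x) (f₁ x) (A₀ x) (A₁ x) := by
    filter_upwards [hp₀, hp₁, hq₀, hq₁] with x a₀ a₁ b₀ b₁
    exact gradDiff_nonneg (by linarith) (by linarith) (by linarith) (by linarith)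
  have hsum : 0 ≤ᵐ[volume.restrict Ω] fun x =>
      lam ^ 2 / κ ^ 2 * ‖weakGrad Ω f₁ x - weakGrad Ω f₀ x‖ ^ 2
        + gradDiff (f₀ x) (f₁ x) (A₀ x) (A₁ x) := by
    filter_upwards [hN] with x hx
    exact add_nonneg (by positivity) hx
  have hsumi : IntegrableOn (fun x => lam ^ 2 / κ ^ 2 * ‖weakGrad Ω f₁ x - weakGrad Ω f₀ x‖ ^ 2
      + gradDiff (f₀ x) (f₁ x) (A₀ x) (A₁ x)) Ω := by
    refine ((i₁.add j₁).sub (i₀.add j₀)).congr ?_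
    filter_upwards [hgrad.weakGrad_ae_eq hΩo] with x hx
    rw [← real_inner_self_eq_norm_sq]
    simp only [Pi.add_apply, Pi.sub_apply, hx, gradDiff, inner_sub_left]
    ring
  have hCi : Integrable fun x => ‖weakCurl A₁ x - weakCurl A₀ x‖ ^ 2 :=
    hC.integrable_norm_pow (by norm_num)
  have n1 := integral_nonneg_of_ae hsum
  have n2 : 0 ≤ ∫ x, ‖weakCurl A₁ x - weakCurl A₀ x‖ ^ 2 :=
    integral_nonneg fun x => by positivity
  have hl2 : 0 < lam ^ 2 := by positivity
  have n3 := mul_nonneg hl2.le n2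
  have z1 := (integral_eq_zero_iff_of_nonneg_ae hsum hsumi).1 (by linarith)
  have z2 := (integral_eq_zero_iff_of_nonneg (fun x => by positivity) hCi).1
    ((mul_eq_zero.1 (by linarith : lam ^ 2 * _ = 0)).resolve_left hl2.ne')
  constructor
  · filter_upwards [hp₀, hp₁, hq₀, hq₁, hN, z1] with x a₀ a₁ b₀ b₁ hx hz
    refine eq_of_gradDiff_eq_zero (by linarith) (by linarith) (by linarith) (by linarith)
      (le_antisymm ?_ hx)
    have : 0 ≤ lam ^ 2 / κ ^ 2 * ‖weakGrad Ω f₁ x - weakGrad Ω f₀ x‖ ^ 2 := by positivity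
    simp only [Pi.zero_apply] at hz
    linarith
  · filter_upwards [z2] with x hx
    have : weakCurl A₁ x - weakCurl A₀ x = 0 := by simpa using hx
    exact (sub_eq_zero.1 this).symm

end Meissner

end

theorem lemma3p11 (Ω : Set Meissner.E3) (hΩ : Meissner.IsBoundedC2Domain Ω)
    (lam κ : ℝ) (hlam : 0 < lam) (hκ : 0 < κ)
    (α : NNReal) (hα0 : 0 < α) (hα1 : α < 1)
    (H : Meissner.E3 → Meissner.E3) (hH : Meissner.AppliedFieldCondition Ω α H)
    (f₀ f₁ : Meissner.E3 → ℝ) (A₀ A₁ : Meissner.E3 → Meissner.E3)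
    (h₀ : Meissner.IsWeakMeissnerSolution Ω lam κ H f₀ A₀)
    (h₁ : Meissner.IsWeakMeissnerSolution Ω lam κ H f₁ A₁)
    (hs₀ : Meissner.StabilityCondition Ω f₀ A₀)
    (hs₁ : Meissner.StabilityCondition Ω f₁ A₁) :
    (∀ᵐ x ∂(MeasureTheory.volume.restrict Ω), f₀ x = f₁ x ∧ A₀ x = A₁ x) ∧
      ∀ᵐ x ∂(MeasureTheory.volume.restrict (Meissner.exterior Ω)),
        Meissner.weakCurl A₀ x = Meissner.weakCurl A₁ x := by
  obtain ⟨h, hc⟩ := h₀.unique hΩ.isOpen hΩ.isBounded hlam h₁ hs₀ hs₁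
  exact ⟨h, MeasureTheory.ae_restrict_of_ae hc⟩
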